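/- **Optimal $1\to2$ cloning of a von Neumann measurement.** Let $d\ge 2$, let $\{|i\rangle\}_{i=1}^d$ be the standard basis of $\mathbb C^d$, and for $U\in SU(d)$ let $E^{(U)}_i=U|i\rangle\langle i|U^\dagger$. Let $\mathcal H_A,\mathcal H_B,\mathcal H_C,\mathcal H_D$ be copies of $\mathbb C^d$. Let $E^{(U)}_{DC}=\sum_i |i\rangle\langle i|_D\otimes (E_i^{(U)})^T_C$ be the Choi operator of the channel $\rho\mapsto\sum_i \mathrm{Tr}[E_i^{(U)}\rho]\,|i\rangle\langle i|$. A *$1\to2$ cloning strategy* is a family $\mathbf R=\{R_{ij}\}_{i,j=1}^d$ of positive semidefinite operators on $\mathcal H_A\otimes\mathcal H_B\otimes\mathcal H_C\otimes\mathcal H_D$ such that $\sum_{ij}R_{ij}=I_D\otimes S_{ABC}$ for some $S$ with $\mathrm{Tr}_C S=I_{AB}$. The measurement it replicates is $G^{(U)}_{ij}=[R_{ij}*E^{(U)}_{DC}]^T$, where $R*E=\mathrm{Tr}_{DC}[R^{\theta_{DC}}(I_{AB}\otimes E)]$ is the link product and $\theta_{DC}$ is partial transposition. Its average fidelity is $$F[\mathbf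 R]=\int_{SU(d)}dU\ \frac1{d^2}\sum_{i,j}\mathrm{Tr}\big[G^{(U)}_{ij}\,(E^{(U)}_i\otimes E^{(U)}_j)\big],$$ with $dU$ the Haar probability measure. Let $|\omega\rangle=\sum_n|n\rangle|n\rangle$, let $P^\pm$ be the projections on the symmetric and antisymmetric subspaces of $\mathcal H_A\otimes\mathcal H_B$, $d_\pm=\mathrm{Tr}P^\pm=d(d\pm1)/2$, and $$|\Psi^\pm_m\rangle=\frac{|\omega\rangle_{AC}|m\rangle_B\pm|m\rangle_A|\omega\rangle_{BC}}{\sqrt{2(d\pm1)}},\qquad P^\alpha\otimes|a\rangle\langle b|=\sum_m|\Psi^a_m\rangle\langle\Psi^b_m|\quad(a,b\in\{+,-\}),$$ $$P^\beta=P^+\otimes I_C-P^\alpha\otimes|+\rangle\langle+|,\qquad P^\gamma=P^-\otimes I_C-P^\alpha\otimes|-\rangle\langle-|.$$ Let $\mathsf L=\{(xx,x),(xx,y),(xy,x),(xy,y),(xy,z)\}$ be the equality patterns of triples $(ij,k)$ of indices in $\{1,\dots,d\}$, where different letters stand for different indices, and let $n(\ell)$ be the number of triples with pattern $\ell$. For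 $2\times2$ complex matrices $s^\alpha_\ell$ and real numbers $s^\beta_\ell,s^\gamma_\ell$ ($\ell\in\mathsf L$), the *symmetric instrument* with these parameters is $$R_{ij}=\sum_k |k\rangle\langle k|_D\otimes\frac{d}{n(\ell)}\big(P^\alpha\otimes s^\alpha_{\ell}+s^\beta_{\ell}P^\beta+s^\gamma_{\ell}P^\gamma\big),\qquad \ell\text{ the pattern of }(ij,k).$$ Put $$A=\begin{pmatrix}\frac{8d_+}{9d}&0\\0&0\end{pmatrix},\qquad B=\begin{pmatrix}\frac{d_+}{9d}&\frac{\sqrt{d_+d_-}}{3d}\\ \frac{\sqrt{d_+d_-}}{3d}&\frac{d_-}{d}\end{pmatrix},\qquad \sigma_z=\begin{pmatrix}1&0\\0&-1\end{pmatrix}.$$ Then: 1. For every cloning strategy the integrand defining $F[\mathbf R]$ is integrable, and the maximum of $F[\mathbf R]$ over all cloning strategies $\mathbf R$ is attained and equals $$F=\frac{4}{3d}.$$ 2. The symmetric instrument $\mathbf R^{(1)}$ with $s^\alpha_{xx,x}=A$, $s^\alpha_{xy,x}=B$ and all other parameters $0$, the symmetric instrument $\mathbf R^{(2)}$ with $s^\alpha_{xx,x}=A$,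 $s^\alpha_{xy,y}=\sigma_zB\sigma_z$ and all other parameters $0$, and every convex combination $p\,\mathbf R^{(1)}+(1-p)\,\mathbf R^{(2)}$, $0\le p\le1$, are cloning strategies with average fidelity $\frac4{3d}$. Conversely, every symmetric instrument that is a cloning strategy with average fidelity $\frac4{3d}$ is one of these convex combinations. 3. For the equal-weight combination $p=\frac12$ the replicated measurement is, for all $U\in SU(d)$ and all $i\ne j$, $$G^{(U)}_{ii}=\tfrac89\,P^+(E^{(U)}_i\otimes I)P^+,\qquad G^{(U)}_{ij}=\frac1{d-1}\Big[Q^+(E^{(U)}_i\otimes I)Q^++Q^-(E^{(U)}_j\otimes I)Q^-\Big],$$ where $Q^\pm=\frac1{\sqrt{18}}P^+\pm\frac1{\sqrt2}P^-$. -/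

import Mathlib

open MeasureTheory
open scoped ComplexOrder Kronecker

noncomputable section

namespace MeasurementCloning

/-! ### Haar measure on the special unitary group -/

/-- The special unitary group of `ℂ^d`. -/
abbrev SU (d : ℕ) : Submonoid (Matrix (Fin d) (Fin d) ℂ) := Matrix.specialUnitaryGroup (Fin d) ℂ

instance instMeasurableSpaceSU (d : ℕ) : MeasurableSpace (SU d) := borel _

instance instBorelSpaceSU (d : ℕ) : BorelSpace (SU d) := ⟨rfl⟩

instance instIsTopologicalGroupSU (d : ℕ) : IsTopologicalGroup (SU d) where
  continuous_inv := by
    refine Continuous.subtype_mk (f := fun U : SU d => star (U : Matrix (Fin d) (Fin d) ℂ)) ?_ _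
    exact continuous_subtype_val.star

instance instCompactSpaceSU (d : ℕ) : CompactSpace (SU d) := by
  have hcl : IsClosed ((SU d : Submonoid (Matrix (Fin d) (Fin d) ℂ)) :
      Set (Matrix (Fin d) (Fin d) ℂ)) := by
    have h : ((SU d : Submonoid (Matrix (Fin d) (Fin d) ℂ)) : Set (Matrix (Fin d) (Fin d) ℂ)) =
        {A | A * star A = 1} ∩ {A | A.det = 1} := by
      ext A
      simp [SU, Matrix.mem_specialUnitaryGroup_iff, Matrix.mem_unitaryGroup_iff]
    rw [h]
    exact (isClosed_eq (continuous_id.mul continuous_id.star) continuous_const).inter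
      (isClosed_eq continuous_id.matrix_det continuous_const)
  have hK : IsCompact {A : Matrix (Fin d) (Fin d) ℂ |
      ∀ i, A i ∈ {v : Fin d → ℂ | ∀ j, v j ∈ Metric.closedBall (0 : ℂ) 1}} :=
    isCompact_pi_infinite (fun _ => isCompact_pi_infinite (fun _ => isCompact_closedBall _ _))
  refine isCompact_iff_compactSpace.mp (hK.of_isClosed_subset hcl ?_)
  intro A hA i j
  have := entry_norm_bound_of_unitary (Matrix.specialUnitaryGroup_le_unitaryGroup hA) i j
  simpa using this

/-- The Haar probability measure `dU` on `SU(d)`. -/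
def haarSU (d : ℕ) : Measure (SU d) := Measure.haarMeasure ⊤

/-! ### Choi operators and the link product -/

/-- The Choi operator `(𝓜 ⊗ 𝓘)(|ω⟩⟨ω|)`, `|ω⟩ = ∑ₙ |n⟩|n⟩`, of a map `𝓜` on matrices; it acts on
`output ⊗ input`. -/
def choi {m n : Type*} [Fintype n] [DecidableEq n]
    (M : Matrix n n ℂ → Matrix m m ℂ) : Matrix (m × n) (m × n) ℂ :=
  ∑ a : n, ∑ b : n, M (Matrix.single a b 1) ⊗ₖ Matrix.single a b 1

/-- Partial trace over the second tensor factor. -/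
def partialTrace {X K : Type*} [Fintype K] (R : Matrix (X × K) (X × K) ℂ) : Matrix X X ℂ :=
  Matrix.of fun x x' => ∑ k, R (x, k) (x', k)

/-- Partial transposition on the second tensor factor. -/
def partialTranspose {X K : Type*} (R : Matrix (X × K) (X × K) ℂ) : Matrix (X × K) (X × K) ℂ :=
  Matrix.of fun p q => R (p.1, q.2) (q.1, p.2)

/-- The link product `R * E = Tr_K [R^{θ_K} (I ⊗ E)]`, where all wires of `E` (the space `K`) are
connected to wires of `R`. -/
def link {X K : Type*} [Fintype X] [DecidableEq X] [Fintype K]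
    (R : Matrix (X × K) (X × K) ℂ) (E : Matrix K K ℂ) : Matrix X X ℂ :=
  partialTrace (partialTranspose R * ((1 : Matrix X X ℂ) ⊗ₖ E))

/-! ### The measurement to be cloned, cloning strategies, and the figure of merit -/

/-- The von Neumann measurement `E_i^{(U)} = U |i⟩⟨i| U†`. -/
def vonNeumann {d : ℕ} (U : SU d) (i : Fin d) : Matrix (Fin d) (Fin d) ℂ :=
  (U : Matrix (Fin d) (Fin d) ℂ) * Matrix.single i i 1 * star (U : Matrix (Fin d) (Fin d) ℂ)

/-- The measure-and-prepare channel `ρ ↦ ∑ᵢ Tr[Eᵢ ρ] |i⟩⟨i|` of a measurement `E`. -/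
def measureAndPrepare {d : ℕ} (E : Fin d → Matrix (Fin d) (Fin d) ℂ)
    (ρ : Matrix (Fin d) (Fin d) ℂ) : Matrix (Fin d) (Fin d) ℂ :=
  ∑ i, (E i * ρ).trace • Matrix.single i i 1

/-- Basis labels `((a, b), c)` of `A ⊗ B ⊗ C`: the two systems to be measured by the clones, and
the system sent into the inserted measurement. -/
abbrev ABC (d : ℕ) : Type := (Fin d × Fin d) × Fin d

/-- Basis labels `((a, b), (k, c))` of all the wires `A ⊗ B ⊗ (D ⊗ C)` of the replicating network,
`D` carrying the outcome of the inserted measurement. -/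
abbrev Wires (d : ℕ) : Type := (Fin d × Fin d) × (Fin d × Fin d)

/-- The operator `M_D ⊗ S_{ABC}`. -/
def tensorD {d : ℕ} (M : Matrix (Fin d) (Fin d) ℂ) (S : Matrix (ABC d) (ABC d) ℂ) :
    Matrix (Wires d) (Wires d) ℂ :=
  Matrix.of fun p q => M p.2.1 q.2.1 * S (p.1, p.2.2) (q.1, q.2.2)

/-- `1 → 2` cloning strategies: generalized instruments `{R_{ij}}` of positive operators with
`∑_{ij} R_{ij} = I_D ⊗ S_{ABC}` and `Tr_C S = I_{AB}`. -/
structure IsCloningStrategy {d : ℕ} (R : Fin d → Fin d → Matrix (Wires d) (Wires d) ℂ) : Prop where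
  posSemidef : ∀ i j, (R i j).PosSemidef
  normalized : ∃ S : Matrix (ABC d) (ABC d) ℂ,
    ∑ i, ∑ j, R i j = tensorD 1 S ∧ partialTrace S = 1

/-- The replicated bipartite measurement `G_{ij}^{(U)} = [R_{ij} * E^{(U)}]ᵀ`, where `E^{(U)}` is
the Choi operator of the measure-and-prepare channel of the inserted measurement. -/
def replicated {d : ℕ} (R : Fin d → Fin d → Matrix (Wires d) (Wires d) ℂ) (U : SU d)
    (i j : Fin d) : Matrix (Fin d × Fin d) (Fin d × Fin d) ℂ :=
  (link (R i j) (choi (measureAndPrepare (vonNeumann U)))).transpose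

/-- `𝓕(P, Q) = (1 / dim) ∑ᵢ Tr[Pᵢ Qᵢ]` (a real number for positive operators). -/
def povmFidelity {ι n : Type*} [Fintype ι] [Fintype n] (P Q : ι → Matrix n n ℂ) : ℝ :=
  (1 / (Fintype.card n : ℝ)) * ∑ i, ((P i * Q i).trace).re

/-- The fidelity between the replicated measurement and `E^{(U)} ⊗ E^{(U)}`. -/
def cloneFidelityAt {d : ℕ} (R : Fin d → Fin d → Matrix (Wires d) (Wires d) ℂ) (U : SU d) : ℝ :=
  povmFidelity (fun ij : Fin d × Fin d => replicated R U ij.1 ij.2)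
    (fun ij : Fin d × Fin d => vonNeumann U ij.1 ⊗ₖ vonNeumann U ij.2)

/-- The average fidelity `F[R]` over Haar-random `U`. -/
def cloneFidelity {d : ℕ} (R : Fin d → Fin d → Matrix (Wires d) (Wires d) ℂ) : ℝ :=
  ∫ U, cloneFidelityAt R U ∂(haarSU d)

/-! ### Symmetric generalized instruments -/

/-- Equality patterns of a triple `(ij, k)`, i.e. its orbit under relabelling. -/
inductive Pattern
  | xxx | xxy | xyx | xyy | xyz
  deriving DecidableEq

/-- The pattern of the triple `(ij, k)`. -/
def pattern {d : ℕ} (i j k : Fin d) : Pattern :=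
  if i = j then (if k = i then .xxx else .xxy)
  else if k = i then .xyx else if k = j then .xyy else .xyz

/-- The number `n(ℓ)` of triples with pattern `ℓ`. -/
def patternCard (d : ℕ) (l : Pattern) : ℕ :=
  (Finset.univ.filter fun t : Fin d × Fin d × Fin d => pattern t.1 t.2.1 t.2.2 = l).card

/-- The swap operator on `A ⊗ B`. -/
def swapAB (d : ℕ) : Matrix (Fin d × Fin d) (Fin d × Fin d) ℂ :=
  Matrix.of fun p q => if p = q.swap then 1 else 0

/-- The projection on the symmetric subspace of `A ⊗ B`. -/
def symProj (d : ℕ) : Matrix (Fin d × Fin d) (Fin d × Fin d) ℂ :=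
  (1 / 2 : ℂ) • (1 + swapAB d)

/-- The projection on the antisymmetric subspace of `A ⊗ B`. -/
def antiProj (d : ℕ) : Matrix (Fin d × Fin d) (Fin d × Fin d) ℂ :=
  (1 / 2 : ℂ) • (1 - swapAB d)

/-- The two values of `ε : Fin 2` stand for the labels `+` and `-`. -/
def sgn (ε : Fin 2) : ℝ := if ε = 0 then 1 else -1

/-- `|Ψ^±_m⟩ = (|ω⟩_{AC} |m⟩_B ± |m⟩_A |ω⟩_{BC}) / √(2(d ± 1))`. -/
def Psi (d : ℕ) (ε : Fin 2) (m : Fin d) : ABC d → ℂ := fun x =>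
  (((if x.1.1 = x.2 ∧ x.1.2 = m then 1 else 0) +
    sgn ε * (if x.1.2 = x.2 ∧ x.1.1 = m then 1 else 0)) / √(2 * (d + sgn ε)) : ℝ)

/-- `P^α ⊗ |a⟩⟨b| = ∑_m |Ψ^a_m⟩⟨Ψ^b_m|`. -/
def alphaBlock (d : ℕ) (a b : Fin 2) : Matrix (ABC d) (ABC d) ℂ :=
  ∑ m, Matrix.vecMulVec (Psi d a m) (star (Psi d b m))

/-- `P^β = P^+ ⊗ I - P^α ⊗ |+⟩⟨+|`. -/
def betaProj (d : ℕ) : Matrix (ABC d) (ABC d) ℂ := symProj d ⊗ₖ 1 - alphaBlock d 0 0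

/-- `P^γ = P^- ⊗ I - P^α ⊗ |-⟩⟨-|`. -/
def gammaProj (d : ℕ) : Matrix (ABC d) (ABC d) ℂ := antiProj d ⊗ₖ 1 - alphaBlock d 1 1

/-- The parameters `s^ν_ℓ`, `ν = α, β, γ`, of a symmetric generalized instrument. -/
structure Params where
  α : Pattern → Matrix (Fin 2) (Fin 2) ℂ
  β : Pattern → ℝ
  γ : Pattern → ℝ

/-- `R_ℓ = P^α ⊗ r^α_ℓ + r^β_ℓ P^β + r^γ_ℓ P^γ`, where `s^ν_ℓ = (n(ℓ) / d) r^ν_ℓ`. -/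
def patternOp (d : ℕ) (s : Params) (l : Pattern) : Matrix (ABC d) (ABC d) ℂ :=
  ((d : ℂ) / patternCard d l) •
    ((∑ a, ∑ b, s.α l a b • alphaBlock d a b) + (s.β l : ℂ) • betaProj d +
      (s.γ l : ℂ) • gammaProj d)

/-- `R_{ij} = ∑_k |k⟩⟨k|_D ⊗ R_{ℓ(ij,k)}`. -/
def instrument (d : ℕ) (s : Params) (i j : Fin d) : Matrix (Wires d) (Wires d) ℂ :=
  ∑ k, tensorD (Matrix.single k k 1) (patternOp d s (pattern i j k))

/-! ### The optimal instruments -/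

/-- `d_+ = Tr P^+`. -/
def dPlus (d : ℕ) : ℝ := d * (d + 1) / 2

/-- `d_- = Tr P^-`. -/
def dMinus (d : ℕ) : ℝ := d * (d - 1) / 2

def matA (d : ℕ) : Matrix (Fin 2) (Fin 2) ℂ :=
  !![((8 * dPlus d / (9 * d) : ℝ) : ℂ), 0; 0, 0]

def matB (d : ℕ) : Matrix (Fin 2) (Fin 2) ℂ :=
  !![((dPlus d / (9 * d) : ℝ) : ℂ), ((√(dPlus d * dMinus d) / (3 * d) : ℝ) : ℂ);
     ((√(dPlus d * dMinus d) / (3 * d) : ℝ) : ℂ), ((dMinus d / d : ℝ) : ℂ)]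

def sigmaZ : Matrix (Fin 2) (Fin 2) ℂ := !![1, 0; 0, -1]

/-- First optimal choice: `s^α_{xx,x} = A`, `s^α_{xy,x} = B`, all others zero. -/
def optParams₁ (d : ℕ) : Params where
  α := fun l => match l with
    | .xxx => matA d
    | .xyx => matB d
    | _ => 0
  β := fun _ => 0
  γ := fun _ => 0

/-- Second optimal choice: `s^α_{xx,x} = A`, `s^α_{xy,y} = σ_z B σ_z`, all others zero. -/
def optParams₂ (d : ℕ) : Params where
  α := fun l => match l with
    | .xxx => matA d
    | .xyy => sigmaZ * matB d * sigmaZ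
    | _ => 0
  β := fun _ => 0
  γ := fun _ => 0

/-- The convex combination, with weights `p` and `1 - p`, of the two optimal choices. -/
def optInstrument (d : ℕ) (p : ℝ) : Fin d → Fin d → Matrix (Wires d) (Wires d) ℂ :=
  p • instrument d (optParams₁ d) + (1 - p) • instrument d (optParams₂ d)

/-- `Q^± = P^+ / √18 ± P^- / √2`. -/
def matQ (d : ℕ) (ε : Fin 2) : Matrix (Fin d × Fin d) (Fin d × Fin d) ℂ :=
  ((1 / √18 : ℝ) : ℂ) • symProj d + ((sgn ε / √2 : ℝ) : ℂ) • antiProj d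

end MeasurementCloning

end

open MeasurementCloning

noncomputable section

namespace MeasurementCloning

/-! ### Haar averages -/

/-! The proof is semidefinite duality. The Choi operator of a measure-and-prepare channel is
diagonal in `D`, so only the diagonal blocks `R_{ij,k}` of a strategy enter, and F = d⁻² ∑_{ijk}
Tr[R_{ij,k} Ω_{ijk}], where Ω_{ijk} (`avgTriple`) is the Haar average of E_iᵀ ⊗ E_jᵀ ⊗ E_k
(`cloneFidelity_eq`). The constraints are ∑_{ij} R_{ij,k} = S for every k and Tr_C S = 1. Hence an
operator Y = Z ⊗ I_C with Y ≥ Ω_{ijk} for all i, j, k gives F ≤ Tr Z / d. The choice Z = 2/(d(d+1))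
P⁺ + 2/(3d(d-1)) P⁻ (`dualOp`) has trace 1 + 1/3, whence 4/(3d) (`cloneFidelity_le`).

Dual feasibility (`posSemidef_dualOp_sub_avgTriple`) needs no third moment. Summing Ω over one index
reduces it to the second moment of a random rank-one projection, and invariance under relabelling
the basis makes the remaining terms of each sum equal. Everything is thereby expressed through P^±,
the projections on ω_{AC} and ω_{BC}, and the positive remainder `avgRest`, which is supported on
P^β and bounded there by a multiple of it. For k = i ≠ j or k = j ≠ i, the resulting lower bound on
(d-1)(Y - Ω) has a rank-one component on the multiplicity space of P^α (`smul_dualOp_sub`); the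
vector orthogonal to it is the one spanning the range of B, or of σ_z B σ_z.

For the optimal instruments each block is a multiple of (T ⊗ I) |ω⟩⟨ω|_{AC} (T ⊗ I), summed over the
basis of B, with T = aP⁺ + bP⁻ (`alphaForm_eq_twist`). Tracing out C against E turns this into T(Eᵀ
⊗ I)T, which yields both the normalization and the replicated measurement. The traces against Ω are
constant in U before averaging, so attaining the bound is arithmetic.

Uniqueness is complementary slackness (`trace_slack_eq_zero`): every Tr[R_{ij,k}(Y - Ω_{ijk})]
vanishes. For a symmetric instrument the α, β, γ components are separately positive, so each
contributes zero. This removes the β and γ components and leaves only multiples of the prescribed α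
blocks (`exists_blocks_of_optimal`); the normalization on P⁻ and P⁺ then fixes the coefficients. -/

instance isProbabilityMeasure_haarSU (d : ℕ) : IsProbabilityMeasure (haarSU d) :=
  ⟨by simpa [haarSU] using Measure.haarMeasure_self (G := SU d) (K₀ := ⊤)⟩

instance isMulLeftInvariant_haarSU (d : ℕ) : (haarSU d).IsMulLeftInvariant :=
  inferInstanceAs (Measure.haarMeasure _).IsMulLeftInvariant

instance isHaarMeasure_haarSU (d : ℕ) : (haarSU d).IsHaarMeasure :=
  inferInstanceAs (Measure.haarMeasure _).IsHaarMeasure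

/-- A compact group is unimodular: the image of Haar measure under a right translation is again left
invariant, hence a multiple of Haar measure, and comparing total masses gives the factor 1. -/
instance isMulRightInvariant_haarSU (d : ℕ) : (haarSU d).IsMulRightInvariant := by
  refine ⟨fun g => ?_⟩
  have hmeas : Measurable fun x : SU d => x * g := (continuous_mul_const g).measurable
  have : IsProbabilityMeasure (Measure.map (fun x => x * g) (haarSU d)) :=
    Measure.isProbabilityMeasure_map hmeas.aemeasurable
  have : (Measure.map (fun x => x * g) (haarSU d)).IsMulLeftInvariant := by
    refine ⟨fun h => ?_⟩
    rw [Measure.map_map (measurable_const_mul h) hmeas]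
    have : ((fun x => h * x) ∘ fun x : SU d => x * g) = (fun x => x * g) ∘ fun x => h * x := by
      funext x; simp [mul_assoc]
    rw [this, ← Measure.map_map hmeas (measurable_const_mul h), map_mul_left_eq_self]
  have h := Measure.isMulInvariant_eq_smul_of_compactSpace
    (Measure.map (fun x => x * g) (haarSU d)) (haarSU d)
  have h1 := congrArg (fun μ : Measure (SU d) => μ Set.univ) h
  simp only [measure_univ, Measure.smul_apply] at h1
  rw [h]
  have h2 : Measure.haarScalarFactor (Measure.map (fun x => x * g) (haarSU d)) (haarSU d) = 1 := by
    simpa [ENNReal.smul_def] using h1.symm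
  rw [h2, one_smul]

theorem Continuous.integrable_haarSU {d : ℕ} {E : Type*} [NormedAddCommGroup E]
    [SecondCountableTopology E] {f : SU d → E} (hf : Continuous f) : Integrable f (haarSU d) := by
  borelize E
  exact hf.integrable_of_hasCompactSupport (HasCompactSupport.of_compactSpace f)

/-- The entrywise Haar average of a matrix-valued function. -/
def haarAvg {d : ℕ} {m n : Type*} (f : SU d → Matrix m n ℂ) : Matrix m n ℂ :=
  Matrix.of fun x y => ∫ U, f U x y ∂(haarSU d)

section haarAvg

variable {d : ℕ} {m n k : Type*} {f g : SU d → Matrix m n ℂ}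

theorem integrable_entry (hf : Continuous f) (x : m) (y : n) :
    Integrable (fun U => f U x y) (haarSU d) :=
  Continuous.integrable_haarSU (hf.matrix_elem x y)

theorem haarAvg_const (A : Matrix m n ℂ) : haarAvg (fun _ : SU d => A) = A := by
  ext x y; simp [haarAvg]

theorem haarAvg_sum {ι : Type*} (s : Finset ι) {F : ι → SU d → Matrix m n ℂ}
    (hF : ∀ i, Continuous (F i)) :
    haarAvg (fun U => ∑ i ∈ s, F i U) = ∑ i ∈ s, haarAvg (F i) := by
  ext x y
  simpa [haarAvg, Matrix.sum_apply] using
    integral_finsetSum s fun i _ => integrable_entry (hF i) x y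

theorem haarAvg_const_mul [Fintype m] (A : Matrix k m ℂ) (hf : Continuous f) :
    haarAvg (fun U => A * f U) = A * haarAvg f := by
  ext x y
  simp only [haarAvg, Matrix.of_apply, Matrix.mul_apply]
  rw [integral_finsetSum _ fun i _ => (integrable_entry hf i y).const_mul _]
  simp [integral_const_mul]

theorem haarAvg_mul_const [Fintype n] (A : Matrix n k ℂ) (hf : Continuous f) :
    haarAvg (fun U => f U * A) = haarAvg f * A := by
  ext x y
  simp only [haarAvg, Matrix.of_apply, Matrix.mul_apply]
  rw [integral_finsetSum _ fun i _ => (integrable_entry hf x i).mul_const _]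
  simp [integral_mul_const]

theorem integral_trace_const_mul [Fintype m] [Fintype n] (A : Matrix n m ℂ) (hf : Continuous f) :
    ∫ U, (A * f U).trace ∂(haarSU d) = (A * haarAvg f).trace := by
  rw [← haarAvg_const_mul A hf]
  simp only [Matrix.trace, Matrix.diag, haarAvg, Matrix.of_apply]
  exact integral_finsetSum _ fun i _ =>
    integrable_entry (f := fun U => A * f U) (continuous_const.matrix_mul hf) i i

/-- The quadratic form of the average at v is the integral of the nonnegative quadratic forms,
obtained by pairing with |v⟩⟨v| under the trace. -/
theorem posSemidef_haarAvg [Fintype m] {f : SU d → Matrix m m ℂ} (hf : Continuous f)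
    (hp : ∀ U, (f U).PosSemidef) : (haarAvg f).PosSemidef := by
  refine Matrix.PosSemidef.of_dotProduct_mulVec_nonneg ?_ fun v => ?_
  · ext x y
    simp only [haarAvg, Matrix.conjTranspose_apply, Matrix.of_apply]
    rw [Complex.star_def, ← integral_conj]
    refine integral_congr_ae (ae_of_all _ fun U => ?_)
    simpa using congrFun (congrFun (hp U).1 x) y
  · have h : star v ⬝ᵥ (haarAvg f).mulVec v = ∫ U, star v ⬝ᵥ (f U).mulVec v ∂(haarSU d) := by
      have := integral_trace_const_mul (Matrix.vecMulVec v (star v)) hf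
      simp only [Matrix.vecMulVec_mul, Matrix.trace_vecMulVec] at this
      simp only [dotProduct_comm v, ← Matrix.dotProduct_mulVec] at this
      exact this.symm
    rw [h]
    exact integral_nonneg fun U => (hp U).dotProduct_mulVec_nonneg v

end haarAvg

/-! ### The rotated basis projections -/

section vonNeumann

variable {d : ℕ}

theorem vonNeumann_apply (U : SU d) (i a b : Fin d) :
    vonNeumann U i a b = U.1 a i * star (U.1 b i) := by
  simp [vonNeumann, Matrix.mul_apply, Matrix.single, Matrix.star_apply, ite_and]

theorem continuous_vonNeumann (i : Fin d) : Continuous fun U : SU d => vonNeumann U i := by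
  unfold vonNeumann
  fun_prop

theorem coe_mem_unitaryGroup (U : SU d) : U.1 ∈ Matrix.unitaryGroup (Fin d) ℂ :=
  Matrix.specialUnitaryGroup_le_unitaryGroup U.2

theorem vonNeumann_mul_vonNeumann (U : SU d) (i j : Fin d) :
    vonNeumann U i * vonNeumann U j = if i = j then vonNeumann U i else 0 := by
  have h := Matrix.mem_unitaryGroup_iff'.1 (coe_mem_unitaryGroup U)
  have : vonNeumann U i * vonNeumann U j = U.1 * (Matrix.single i i 1 *
      (star U.1 * U.1) * Matrix.single j j 1) * star U.1 := by
    simp only [vonNeumann, Matrix.mul_assoc]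
  rw [this, h, Matrix.mul_one]
  split_ifs with hij
  · subst hij; simp [vonNeumann]
  · simp [Matrix.single_mul_single_of_ne, hij]

theorem sum_vonNeumann (U : SU d) : ∑ i, vonNeumann U i = 1 := by
  have h := Matrix.mem_unitaryGroup_iff.1 (coe_mem_unitaryGroup U)
  simp only [vonNeumann, ← Finset.sum_mul, ← Finset.mul_sum]
  rw [Matrix.sum_single_one, Matrix.mul_one, h]

theorem conjTranspose_vonNeumann (U : SU d) (i : Fin d) :
    (vonNeumann U i).conjTranspose = vonNeumann U i := by
  ext a b; simp [vonNeumann_apply, mul_comm]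

theorem trace_vonNeumann (U : SU d) (i : Fin d) : (vonNeumann U i).trace = 1 := by
  have h := Matrix.mem_unitaryGroup_iff'.1 (coe_mem_unitaryGroup U)
  rw [vonNeumann, Matrix.trace_mul_comm, ← Matrix.mul_assoc, h, Matrix.one_mul]
  simp

theorem posSemidef_vonNeumann (U : SU d) (i : Fin d) : (vonNeumann U i).PosSemidef := by
  have := Matrix.posSemidef_conjTranspose_mul_self (vonNeumann U i)
  rwa [conjTranspose_vonNeumann, vonNeumann_mul_vonNeumann, if_pos rfl] at this

/-- Every unitary is a phase times a special unitary. -/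
theorem exists_phase_smul_mem_SU {W : Matrix (Fin d) (Fin d) ℂ} (hd : d ≠ 0)
    (hW : W ∈ Matrix.unitaryGroup (Fin d) ℂ) : ∃ c : ℂ, c * star c = 1 ∧ c • W ∈ SU d := by
  have hdet : W.det * star W.det = 1 := by
    have := congrArg Matrix.det (Matrix.mem_unitaryGroup_iff.1 hW)
    rwa [Matrix.det_mul, Matrix.star_eq_conjTranspose, Matrix.det_conjTranspose,
      Matrix.det_one] at this
  -- Scaling by c multiplies the determinant by c ^ d, so c must be a d-th root of the conjugate of
  -- det W.
  obtain ⟨c, hc⟩ := IsAlgClosed.exists_pow_nat_eq (star W.det) (Nat.pos_of_ne_zero hd)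
  have hnorm : ‖c‖ = 1 := by
    have h1 : ‖W.det‖ = 1 := by
      have := congrArg norm hdet
      simp only [norm_mul, norm_star, norm_one] at this
      nlinarith [norm_nonneg W.det]
    have h2 : ‖c‖ ^ d = 1 := by rw [← norm_pow, hc, norm_star, h1]
    exact (pow_eq_one_iff_of_nonneg (norm_nonneg c) hd).1 h2
  have hcc : c * star c = 1 := by
    rw [Complex.star_def, Complex.mul_conj, Complex.normSq_eq_norm_sq, hnorm]; simp
  refine ⟨c, hcc, Matrix.mem_specialUnitaryGroup_iff.2 ⟨?_, ?_⟩⟩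
  · rw [Matrix.mem_unitaryGroup_iff] at hW ⊢
    rw [star_smul, Matrix.smul_mul, Matrix.mul_smul, smul_smul, hW, hcc, one_smul]
  · rw [Matrix.det_smul, Fintype.card_fin, hc, mul_comm, hdet]

/-- The phase relating W to a special unitary cancels in U|i⟩⟨i|U†, so averages over SU(d) are
invariant under conjugation by all of U(d). -/
theorem integral_conj_vonNeumann {E : Type*} [NormedAddCommGroup E] [NormedSpace ℝ E] (hd : d ≠ 0)
    {W : Matrix (Fin d) (Fin d) ℂ} (hW : W ∈ Matrix.unitaryGroup (Fin d) ℂ)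
    (F : (Fin d → Matrix (Fin d) (Fin d) ℂ) → E) :
    ∫ U, F (fun i => W * vonNeumann U i * star W) ∂(haarSU d) =
      ∫ U, F (vonNeumann U) ∂(haarSU d) := by
  obtain ⟨c, hc, hcW⟩ := exists_phase_smul_mem_SU hd hW
  rw [← integral_mul_left_eq_self (fun U => F (vonNeumann U)) (⟨c • W, hcW⟩ : SU d)]
  congr 1
  funext U
  congr 1
  funext i
  have h : (starRingEnd ℂ) c * c = 1 := by rw [mul_comm]; exact hc
  simp [vonNeumann, Matrix.mul_assoc, smul_smul, h]

/-- The unitary matrix of a permutation. -/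
def permUnitary (π : Equiv.Perm (Fin d)) : Matrix (Fin d) (Fin d) ℂ :=
  Matrix.of fun a b => if a = π b then 1 else 0

theorem permUnitary_mem (π : Equiv.Perm (Fin d)) :
    permUnitary π ∈ Matrix.unitaryGroup (Fin d) ℂ := by
  rw [Matrix.mem_unitaryGroup_iff']
  ext a b
  simp [permUnitary, Matrix.mul_apply, Matrix.star_apply, Matrix.one_apply, eq_comm]

/-- Right multiplication by a permutation matrix permutes the columns of U; its sign is absorbed
into a phase, which the projections do not see. -/
theorem integral_perm_vonNeumann {E : Type*} [NormedAddCommGroup E] [NormedSpace ℝ E] (hd : d ≠ 0)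
    (π : Equiv.Perm (Fin d)) (F : (Fin d → Matrix (Fin d) (Fin d) ℂ) → E) :
    ∫ U, F (fun i => vonNeumann U (π i)) ∂(haarSU d) = ∫ U, F (vonNeumann U) ∂(haarSU d) := by
  obtain ⟨c, hc, hcW⟩ := exists_phase_smul_mem_SU hd (permUnitary_mem π)
  rw [← integral_mul_right_eq_self (fun U => F (vonNeumann U)) (⟨c • permUnitary π, hcW⟩ : SU d)]
  congr 1
  funext U
  congr 1
  funext i
  ext a b
  simp only [vonNeumann_apply, Submonoid.coe_mul, Matrix.mul_smul, Matrix.smul_apply, smul_eq_mul,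
    star_mul']
  have h : ∀ x, (U.1 * permUnitary π) x i = U.1 x (π i) := by
    intro x; simp [permUnitary, Matrix.mul_apply]
  rw [h, h]
  linear_combination (- U.1 a (π i) * star (U.1 b (π i))) * hc

end vonNeumann

/-! ### The second moment of a Haar-random rank-one projection -/

section secondMoment

variable {n : Type*} [Fintype n] [DecidableEq n]

/-- A reflection with phase `t` along the range of a projection. -/
theorem one_add_smul_mem_unitaryGroup {Q : Matrix n n ℂ} (hQ : star Q = Q) (hQQ : Q * Q = Q)
    {t : ℂ} (ht : t * star t = 1) : 1 + (t - 1) • Q ∈ Matrix.unitaryGroup n ℂ := by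
  rw [Matrix.mem_unitaryGroup_iff]
  simp only [star_add, star_one, star_smul, hQ, star_sub, add_mul, mul_add, one_mul, mul_one,
    smul_mul_assoc, mul_smul_comm, hQQ]
  match_scalars
  · ring
  · linear_combination ht

/-- The derivation `X ↦ X ⊗ 1 + 1 ⊗ X`. -/
def kronDeriv (X : Matrix n n ℂ) : Matrix (n × n) (n × n) ℂ := X ⊗ₖ 1 + 1 ⊗ₖ X

theorem kronDeriv_mul_add (X Y : Matrix n n ℂ) :
    kronDeriv X * kronDeriv Y + kronDeriv Y * kronDeriv X =
      kronDeriv (X * Y + Y * X) + (2 : ℂ) • (X ⊗ₖ Y + Y ⊗ₖ X) := by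
  simp only [kronDeriv, add_mul, mul_add, ← Matrix.mul_kronecker_mul, Matrix.mul_one,
    Matrix.one_mul, Matrix.add_kronecker, Matrix.kronecker_add, two_smul]
  abel

variable {M : Matrix (n × n) (n × n) ℂ}

/-- For W = 1 + (t-1)Q the operator W ⊗ W is quadratic in t - 1, with the derivation of Q as its
linear coefficient. Two values of t suffice to isolate that coefficient, so no differentiation along
one-parameter groups is needed. -/
theorem commute_kronDeriv_of_proj
    (hM : ∀ W ∈ Matrix.unitaryGroup n ℂ, Commute M (W ⊗ₖ W))
    {Q : Matrix n n ℂ} (hQ : star Q = Q) (hQQ : Q * Q = Q) : Commute M (kronDeriv Q) := by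
  have key : ∀ t : ℂ, (1 + (t - 1) • Q) ⊗ₖ (1 + (t - 1) • Q) =
      1 + (t - 1) • kronDeriv Q + (t - 1) ^ 2 • (Q ⊗ₖ Q) := by
    intro t
    simp only [kronDeriv, Matrix.add_kronecker, Matrix.kronecker_add, Matrix.smul_kronecker,
      Matrix.kronecker_smul, Matrix.one_kronecker_one]
    module
  have h1 := hM _ (one_add_smul_mem_unitaryGroup hQ hQQ (t := -1) (by simp))
  have h2 := hM _ (one_add_smul_mem_unitaryGroup hQ hQQ (t := Complex.I) (by simp))
  rw [key] at h1 h2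
  -- The coefficients of Q ⊗ Q at t = -1 and t = i are 4 and -2i; the weights i and 2 make them
  -- cancel.
  have h3 : kronDeriv Q = (-1 / 2 : ℂ) • (Complex.I • (1 + ((-1 : ℂ) - 1) • kronDeriv Q +
      ((-1 : ℂ) - 1) ^ 2 • (Q ⊗ₖ Q)) + (2 : ℂ) • (1 + (Complex.I - 1) • kronDeriv Q +
      (Complex.I - 1) ^ 2 • (Q ⊗ₖ Q)) - (Complex.I + 2) • (1 : Matrix (n × n) (n × n) ℂ)) := by
    match_scalars
    · ring
    · ring
    · ring_nf; simp
  rw [h3]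
  exact (((h1.smul_right _).add_right (h2.smul_right _)).sub_right
    ((Commute.one_right M).smul_right _)).smul_right _

theorem commute_kronDeriv_single
    (hM : ∀ W ∈ Matrix.unitaryGroup n ℂ, Commute M (W ⊗ₖ W)) (a b : n) :
    Commute M (kronDeriv (Matrix.single a b 1)) := by
  have hlin : ∀ (c : ℂ) (X Y : Matrix n n ℂ), kronDeriv (c • X + Y) =
      c • kronDeriv X + kronDeriv Y := by
    intro c X Y
    simp only [kronDeriv, Matrix.add_kronecker, Matrix.kronecker_add, Matrix.smul_kronecker,
      Matrix.kronecker_smul]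
    module
  by_cases hab : a = b
  · subst hab
    refine commute_kronDeriv_of_proj hM ?_ (by simp)
    rw [Matrix.star_eq_conjTranspose, Matrix.conjTranspose_single, star_one]
  -- For |s| = 1 this is the projection on the line of |a⟩ + s|b⟩; polarization over s = ±1, ±i
  -- recovers the off-diagonal matrix unit.
  · let Q : ℂ → Matrix n n ℂ := fun s => (1 / 2 : ℂ) • (Matrix.single a a 1 + Matrix.single b b 1 +
      star s • Matrix.single a b 1 + s • Matrix.single b a 1)
    have hQ : ∀ s : ℂ, s * star s = 1 → Commute M (kronDeriv (Q s)) := by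
      intro s hs
      refine commute_kronDeriv_of_proj hM ?_ ?_
      · simp only [Q, star_smul, star_add, Matrix.star_eq_conjTranspose, Matrix.conjTranspose_single,
          star_one, star_star]
        simp only [star_div₀, star_one, star_ofNat]
        abel_nf
      · have hba : b ≠ a := fun h => hab h.symm
        simp only [Q, smul_mul_assoc, mul_smul_comm, add_mul, mul_add, smul_smul, smul_add,
          Matrix.single_mul_single_same, Matrix.single_mul_single_of_ne _ _ _ _ hab,
          Matrix.single_mul_single_of_ne _ _ _ _ hba, mul_one, smul_zero]
        match_scalars <;> first | linear_combination hs / 4 | ring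
    have h3 : kronDeriv (Matrix.single a b 1) = (1 / 2 : ℂ) • (kronDeriv (Q 1) - kronDeriv (Q (-1))
        + Complex.I • kronDeriv (Q Complex.I) - Complex.I • kronDeriv (Q (-Complex.I))) := by
      simp only [Q, kronDeriv, Matrix.add_kronecker, Matrix.kronecker_add, Matrix.smul_kronecker,
        Matrix.kronecker_smul]
      match_scalars <;> simp <;> ring_nf <;> simp <;> norm_num
    rw [h3]
    exact ((((hQ 1 (by simp)).sub_right (hQ (-1) (by simp))).add_right
      ((hQ Complex.I (by simp)).smul_right _)).sub_right
      ((hQ (-Complex.I) (by simp)).smul_right _)).smul_right _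

theorem commute_kronDeriv
    (hM : ∀ W ∈ Matrix.unitaryGroup n ℂ, Commute M (W ⊗ₖ W)) (X : Matrix n n ℂ) :
    Commute M (kronDeriv X) := by
  induction X using Matrix.induction_on' with
  | h_zero => simp [kronDeriv]
  | h_add X Y hX hY =>
    have : kronDeriv (X + Y) = kronDeriv X + kronDeriv Y := by
      simp only [kronDeriv, Matrix.add_kronecker, Matrix.kronecker_add]; abel
    rw [this]
    exact hX.add_right hY
  | h_std_basis a b x =>
    have : kronDeriv (Matrix.single a b x) = x • kronDeriv (Matrix.single a b (1 : ℂ)) := by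
      rw [kronDeriv, kronDeriv, smul_add, ← Matrix.smul_kronecker, ← Matrix.kronecker_smul]
      simp
    rw [this]
    exact (commute_kronDeriv_single hM a b).smul_right x

/-- A symmetric operator commuting with all `W ⊗ W` is a multiple of the symmetric projection. -/
theorem apply_of_commute_kronecker
    (hM : ∀ W ∈ Matrix.unitaryGroup n ℂ, Commute M (W ⊗ₖ W))
    (hsymm : ∀ x y, M x y.swap = M x y) (o : n) (x : n × n) (a c : n) :
    2 * M x (a, c) = ((if x = (a, c) then 1 else 0) + (if x = (c, a) then 1 else 0)) *
      M (o, o) (o, o) := by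
  have h1 := commute_kronDeriv hM (Matrix.single a o 1)
  have h2 := commute_kronDeriv hM (Matrix.single c o 1)
  -- By `kronDeriv_mul_add`, the anticommutator of two derivations is a derivation plus twice the
  -- symmetrized tensor product, so M commutes with the latter. This product sends |oo⟩ to |ac⟩ +
  -- |ca⟩, so the column at (o, o) determines M on symmetric vectors.
  have h3 : Commute M (Matrix.single a o (1 : ℂ) ⊗ₖ Matrix.single c o (1 : ℂ) +
      Matrix.single c o (1 : ℂ) ⊗ₖ Matrix.single a o (1 : ℂ)) := by
    have := ((h1.mul_right h2).add_right (h2.mul_right h1)).sub_right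
      (commute_kronDeriv hM (Matrix.single a o 1 * Matrix.single c o 1 +
        Matrix.single c o 1 * Matrix.single a o 1))
    rw [kronDeriv_mul_add, add_sub_cancel_left] at this
    simpa using this.smul_right (1 / 2 : ℂ)
  have h4 := congrFun (congrFun h3.eq x) (o, o)
  have hx : M x (c, a) = M x (a, c) := hsymm x (a, c)
  have hl : ∀ y z : n × n, (Matrix.single y z (1 : ℂ) * M) x z = if x = y then M z z else 0 := by
    intro y z
    split_ifs with h
    · subst h; simp
    · simp [h]
  simp only [Matrix.single_kronecker_single, mul_one, Matrix.mul_add, Matrix.add_mul,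
    Matrix.add_apply, Matrix.mul_single_apply_same, hl, hx] at h4
  rw [two_mul, h4, add_mul, ite_mul, ite_mul, one_mul, zero_mul]

end secondMoment

theorem continuous_vonNeumann_kronecker {d : ℕ} (i j : Fin d) :
    Continuous fun U : SU d => vonNeumann U i ⊗ₖ vonNeumann U j :=
  continuous_pi fun _ => continuous_pi fun _ =>
    ((continuous_vonNeumann i).matrix_elem _ _).mul ((continuous_vonNeumann j).matrix_elem _ _)

/-- By invariance under W ⊗ W and the swap symmetry of a rank-one E ⊗ E, the average is a multiple
of P⁺; its trace is 1, which fixes the multiple as 1/Tr P⁺. -/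
theorem haarAvg_vonNeumann_kronecker_self {d : ℕ} (i a b a' b' : Fin d) :
    haarAvg (fun U => vonNeumann U i ⊗ₖ vonNeumann U i) (a, b) (a', b') =
      ((if a = a' ∧ b = b' then 1 else 0) + (if a = b' ∧ b = a' then 1 else 0)) /
        (d * (d + 1)) := by
  have hd : d ≠ 0 := fun h => (Fin.cast h i).elim0
  set M := haarAvg (fun U => vonNeumann U i ⊗ₖ vonNeumann U i) with hMdef
  have hcont := continuous_vonNeumann_kronecker i i
  have hcomm : ∀ W ∈ Matrix.unitaryGroup (Fin d) ℂ, Commute M (W ⊗ₖ W) := by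
    intro W hW
    have h1 : M = haarAvg (fun U => (W ⊗ₖ W) * (vonNeumann U i ⊗ₖ vonNeumann U i) *
        (star W ⊗ₖ star W)) := by
      ext x y
      have := integral_conj_vonNeumann hd hW (fun E => (E i ⊗ₖ E i) x y)
      simp only [Matrix.mul_kronecker_mul] at this
      exact this.symm
    rw [haarAvg_mul_const _ (continuous_const.matrix_mul hcont), haarAvg_const_mul _ hcont] at h1
    have h2 : (star W ⊗ₖ star W) * (W ⊗ₖ W) = 1 := by
      rw [← Matrix.mul_kronecker_mul, Matrix.mem_unitaryGroup_iff'.1 hW, Matrix.one_kronecker_one]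
    calc M * (W ⊗ₖ W) = (W ⊗ₖ W) * M * (star W ⊗ₖ star W) * (W ⊗ₖ W) := by rw [← h1]
      _ = (W ⊗ₖ W) * M := by rw [Matrix.mul_assoc _ (star W ⊗ₖ star W), h2, Matrix.mul_one]
  have hsymm : ∀ x y, M x y.swap = M x y := by
    intro x y
    refine integral_congr_ae (ae_of_all _ fun U => ?_)
    simp only [Matrix.kroneckerMap_apply, vonNeumann_apply, Prod.fst_swap, Prod.snd_swap]
    ring
  have hform := apply_of_commute_kronecker hcomm hsymm i
  have htr : M.trace = 1 := by
    have := integral_trace_const_mul (1 : Matrix (Fin d × Fin d) (Fin d × Fin d) ℂ) hcont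
    simpa [Matrix.trace_kronecker, trace_vonNeumann] using this.symm
  have h2 : 2 * M.trace = (d * (d + 1)) * M (i, i) (i, i) := by
    rw [Matrix.trace, Finset.mul_sum, Fintype.sum_prod_type]
    simp only [Matrix.diag_apply, hform]
    simp only [Prod.mk.injEq, ← Finset.sum_mul, Finset.sum_add_distrib]
    congr 1
    simp [ite_and]
    ring
  rw [htr] at h2
  have hd' : (d : ℂ) * (d + 1) ≠ 0 := by exact_mod_cast Nat.mul_ne_zero hd d.succ_ne_zero
  have h3 := hform (a, b) a' b'
  simp only [Prod.mk.injEq] at h3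
  rw [eq_div_iff hd']
  linear_combination (d * (d + 1) / 2 : ℂ) * h3 -
    ((if a = a' ∧ b = b' then 1 else 0) + (if a = b' ∧ b = a' then 1 else 0)) / 2 * h2

/-! ### The algebra commuting with `U ⊗ U ⊗ Ū` -/

section algebra

variable {d : ℕ}

/-- `|ω⟩_{AC} |m⟩_B` for `r = 0` and `|m⟩_A |ω⟩_{BC}` for `r = 1`. -/
def omegaVec (d : ℕ) (r : Fin 2) (m : Fin d) : ABC d → ℂ := fun x =>
  if r = 0 then (if x.1.1 = x.2 ∧ x.1.2 = m then 1 else 0)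
  else (if x.1.2 = x.2 ∧ x.1.1 = m then 1 else 0)

/-- The operators `∑_m |χ^r_m⟩⟨χ^s_m|` built from `χ^r_m = omegaVec d r m`. -/
def omegaOp (d : ℕ) (r s : Fin 2) : Matrix (ABC d) (ABC d) ℂ :=
  ∑ m, Matrix.vecMulVec (omegaVec d r m) (star (omegaVec d s m))

/-- The normalization of `Psi`. -/
def psiNorm (d : ℕ) (ε : Fin 2) : ℝ := 1 / √(2 * (d + sgn ε))

@[simp] theorem sgn_zero : sgn 0 = 1 := rfl

@[simp] theorem sgn_one : sgn 1 = -1 := rfl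

theorem two_mul_add_sgn_pos (hd : 2 ≤ d) (ε : Fin 2) : (0 : ℝ) < 2 * (d + sgn ε) := by
  have : (2 : ℝ) ≤ d := by exact_mod_cast hd
  fin_cases ε <;> simp <;> linarith

theorem psiNorm_sq (hd : 2 ≤ d) (ε : Fin 2) : psiNorm d ε ^ 2 * (2 * (d + sgn ε)) = 1 := by
  have h := two_mul_add_sgn_pos hd ε
  rw [psiNorm, div_pow, Real.sq_sqrt h.le, one_pow, one_div, inv_mul_cancel₀ h.ne']

theorem sqrt_half_mul_psiNorm (hd : 2 ≤ d) (ε : Fin 2) :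
    √((d + sgn ε) / 2) * psiNorm d ε = 1 / 2 := by
  have h := two_mul_add_sgn_pos hd ε
  have h2 : ((d : ℝ) + sgn ε) / 2 = (√(2 * (d + sgn ε)) / 2) ^ 2 := by
    rw [div_pow, Real.sq_sqrt h.le]; ring
  rw [h2, Real.sqrt_sq (by positivity), psiNorm]
  field_simp [(Real.sqrt_pos.2 h).ne']

theorem Psi_eq (ε : Fin 2) (m : Fin d) : Psi d ε m =
    (psiNorm d ε : ℂ) • (omegaVec d 0 m + (sgn ε : ℂ) • omegaVec d 1 m) := by
  funext x
  simp only [Psi, psiNorm, omegaVec, Pi.smul_apply, Pi.add_apply, smul_eq_mul]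
  have h : ∀ (P : Prop) [Decidable P], ((if P then (1 : ℝ) else 0 : ℝ) : ℂ) = if P then 1 else 0 := by
    intro P _; split_ifs <;> simp
  push_cast [h]
  ring

theorem star_omegaVec (r : Fin 2) (m : Fin d) : star (omegaVec d r m) = omegaVec d r m := by
  funext x
  simp only [omegaVec, Pi.star_apply]
  split_ifs <;> simp

theorem star_Psi (ε : Fin 2) (m : Fin d) : star (Psi d ε m) = Psi d ε m := by
  rw [Psi_eq, star_smul, star_add, star_smul, star_omegaVec, star_omegaVec]
  simp

theorem omegaVec_dotProduct (r s : Fin 2) (m n : Fin d) :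
    omegaVec d r m ⬝ᵥ omegaVec d s n = if m = n then (if r = s then (d : ℂ) else 1) else 0 := by
  fin_cases r <;> fin_cases s <;>
    by_cases h : m = n <;>
    simp [omegaVec, dotProduct, Fintype.sum_prod_type, ite_and, h, eq_comm (a := n)]

theorem Psi_dotProduct (hd : 2 ≤ d) (a b : Fin 2) (m n : Fin d) :
    Psi d a m ⬝ᵥ Psi d b n = if a = b ∧ m = n then 1 else 0 := by
  have h : ∀ ε, (psiNorm d ε : ℂ) ^ 2 * (2 * (d + sgn ε)) = 1 := fun ε => by
    exact_mod_cast psiNorm_sq hd ε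
  have h0 := h 0
  have h1 := h 1
  simp only [sgn_zero, sgn_one] at h0 h1
  push_cast at h0 h1
  simp only [Psi_eq, smul_dotProduct, dotProduct_smul, add_dotProduct, dotProduct_add,
    omegaVec_dotProduct, smul_eq_mul]
  by_cases hmn : m = n
  · fin_cases a <;> fin_cases b <;> simp [hmn]
    · linear_combination h0
    · ring_nf; simp
    · ring_nf; simp
    · linear_combination h1
  · simp [hmn]

theorem swap_mulVec_Psi (ε : Fin 2) (m : Fin d) :
    (swapAB d ⊗ₖ (1 : Matrix (Fin d) (Fin d) ℂ)).mulVec (Psi d ε m) = (sgn ε : ℂ) • Psi d ε m := by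
  have hsw : ∀ v : ABC d → ℂ, (swapAB d ⊗ₖ (1 : Matrix (Fin d) (Fin d) ℂ)).mulVec v =
      fun x => v (x.1.swap, x.2) := by
    intro v
    funext x
    simp [Matrix.mulVec, dotProduct, Fintype.sum_prod_type, swapAB, Matrix.one_apply, ite_and,
      Prod.ext_iff, Prod.swap]
  rw [hsw]
  funext x
  have h : (sgn ε : ℂ) * sgn ε = 1 := by fin_cases ε <;> simp
  simp only [Psi_eq, omegaVec, Pi.smul_apply, Pi.add_apply, smul_eq_mul, if_true, one_ne_zero,
    if_false, Prod.fst_swap, Prod.snd_swap]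
  linear_combination (-(psiNorm d ε : ℂ) * if x.1.2 = x.2 ∧ x.1.1 = m then 1 else 0) * h

/-- `P^+ ⊗ I_C`. -/
abbrev symABC (d : ℕ) : Matrix (ABC d) (ABC d) ℂ := symProj d ⊗ₖ 1

/-- `P^- ⊗ I_C`. -/
abbrev antiABC (d : ℕ) : Matrix (ABC d) (ABC d) ℂ := antiProj d ⊗ₖ 1

theorem swapAB_mul_swapAB : swapAB d * swapAB d = 1 := by
  ext x y
  simp [swapAB, Matrix.mul_apply, Fintype.sum_prod_type, Matrix.one_apply, Prod.ext_iff, ite_and]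

theorem conjTranspose_swapAB : (swapAB d).conjTranspose = swapAB d := by
  ext x y
  simp [swapAB, Prod.ext_iff, and_comm, eq_comm]

theorem trace_swapAB : (swapAB d).trace = d := by
  simp [swapAB, Matrix.trace, Fintype.sum_prod_type, ite_and, Prod.ext_iff]

theorem symProj_mul_symProj : symProj d * symProj d = symProj d := by
  simp only [symProj, smul_mul_smul_comm, add_mul, mul_add, one_mul, mul_one, swapAB_mul_swapAB]
  module

theorem antiProj_mul_antiProj : antiProj d * antiProj d = antiProj d := by
  simp only [antiProj, smul_mul_smul_comm, sub_mul, mul_sub, one_mul, mul_one, swapAB_mul_swapAB]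
  module

theorem symProj_mul_antiProj : symProj d * antiProj d = 0 := by
  simp only [symProj, antiProj, smul_mul_smul_comm, add_mul, mul_sub, one_mul, mul_one,
    swapAB_mul_swapAB]
  module

theorem antiProj_mul_symProj : antiProj d * symProj d = 0 := by
  simp only [symProj, antiProj, smul_mul_smul_comm, sub_mul, mul_add, one_mul, mul_one,
    swapAB_mul_swapAB]
  module

theorem symProj_add_antiProj : symProj d + antiProj d = 1 := by
  simp only [symProj, antiProj]
  module

theorem conjTranspose_symProj : (symProj d).conjTranspose = symProj d := by
  rw [symProj, Matrix.conjTranspose_smul, Matrix.conjTranspose_add, conjTranspose_swapAB]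
  simp

theorem conjTranspose_antiProj : (antiProj d).conjTranspose = antiProj d := by
  rw [antiProj, Matrix.conjTranspose_smul, Matrix.conjTranspose_sub, conjTranspose_swapAB]
  simp

theorem trace_symProj : (symProj d).trace = d * (d + 1) / 2 := by
  rw [symProj, Matrix.trace_smul, Matrix.trace_add, trace_swapAB, Matrix.trace_one]
  simp
  ring

theorem trace_antiProj : (antiProj d).trace = d * (d - 1) / 2 := by
  rw [antiProj, Matrix.trace_smul, Matrix.trace_sub, trace_swapAB, Matrix.trace_one]
  simp
  ring

theorem symABC_mul_symABC : symABC d * symABC d = symABC d := by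
  rw [← Matrix.mul_kronecker_mul, symProj_mul_symProj, Matrix.one_mul]

theorem antiABC_mul_antiABC : antiABC d * antiABC d = antiABC d := by
  rw [← Matrix.mul_kronecker_mul, antiProj_mul_antiProj, Matrix.one_mul]

theorem symABC_mul_antiABC : symABC d * antiABC d = 0 := by
  rw [← Matrix.mul_kronecker_mul, symProj_mul_antiProj, Matrix.zero_kronecker]

theorem antiABC_mul_symABC : antiABC d * symABC d = 0 := by
  rw [← Matrix.mul_kronecker_mul, antiProj_mul_symProj, Matrix.zero_kronecker]

theorem symABC_add_antiABC : symABC d + antiABC d = 1 := by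
  rw [← Matrix.add_kronecker, symProj_add_antiProj, Matrix.one_kronecker_one]

theorem conjTranspose_symABC : (symABC d).conjTranspose = symABC d := by
  rw [Matrix.conjTranspose_kronecker, conjTranspose_symProj, Matrix.conjTranspose_one]

theorem conjTranspose_antiABC : (antiABC d).conjTranspose = antiABC d := by
  rw [Matrix.conjTranspose_kronecker, conjTranspose_antiProj, Matrix.conjTranspose_one]

theorem trace_symABC : (symABC d).trace = d * (d + 1) / 2 * d := by
  rw [Matrix.trace_kronecker, trace_symProj, Matrix.trace_one, Fintype.card_fin]

theorem trace_antiABC : (antiABC d).trace = d * (d - 1) / 2 * d := by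
  rw [Matrix.trace_kronecker, trace_antiProj, Matrix.trace_one, Fintype.card_fin]

/-! ### Multiplication table and traces of the invariant blocks -/

theorem symABC_mulVec_Psi (ε : Fin 2) (m : Fin d) :
    (symABC d).mulVec (Psi d ε m) = if ε = 0 then Psi d ε m else 0 := by
  have h := swap_mulVec_Psi ε m
  rw [symABC, symProj, Matrix.smul_kronecker, Matrix.add_kronecker, Matrix.one_kronecker_one,
    Matrix.smul_mulVec, Matrix.add_mulVec, h, Matrix.one_mulVec]
  fin_cases ε <;> simp
  module

theorem antiABC_mulVec_Psi (ε : Fin 2) (m : Fin d) :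
    (antiABC d).mulVec (Psi d ε m) = if ε = 1 then Psi d ε m else 0 := by
  have h := swap_mulVec_Psi ε m
  rw [antiABC, antiProj, Matrix.smul_kronecker, sub_eq_add_neg, Matrix.add_kronecker,
    Matrix.one_kronecker_one, ← neg_one_smul ℂ (swapAB d), Matrix.smul_kronecker, Matrix.smul_mulVec, Matrix.add_mulVec, Matrix.smul_mulVec, h, Matrix.one_mulVec]
  fin_cases ε <;> simp
  module

theorem conjTranspose_alphaBlock (a b : Fin 2) :
    (alphaBlock d a b).conjTranspose = alphaBlock d b a := by
  simp [alphaBlock, Matrix.conjTranspose_sum, Matrix.conjTranspose_vecMulVec]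

theorem alphaBlock_mulVec_Psi (hd : 2 ≤ d) (a b c : Fin 2) (m : Fin d) :
    (alphaBlock d a b).mulVec (Psi d c m) = if b = c then Psi d a m else 0 := by
  simp only [alphaBlock, Matrix.sum_mulVec, Matrix.vecMulVec_mulVec, star_Psi, Psi_dotProduct hd]
  by_cases h : b = c <;> simp [h]

theorem mul_alphaBlock (X : Matrix (ABC d) (ABC d) ℂ) (a b : Fin 2) : X * alphaBlock d a b =
    ∑ m, Matrix.vecMulVec (X.mulVec (Psi d a m)) (star (Psi d b m)) := by
  simp [alphaBlock, Matrix.mul_sum, Matrix.mul_vecMulVec]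

theorem alphaBlock_mul_alphaBlock (hd : 2 ≤ d) (a b a' b' : Fin 2) :
    alphaBlock d a b * alphaBlock d a' b' = if b = a' then alphaBlock d a b' else 0 := by
  rw [mul_alphaBlock]
  simp only [alphaBlock_mulVec_Psi hd]
  split_ifs <;> simp [alphaBlock]

theorem symABC_mul_alphaBlock (a b : Fin 2) :
    symABC d * alphaBlock d a b = if a = 0 then alphaBlock d a b else 0 := by
  rw [mul_alphaBlock]
  simp only [symABC_mulVec_Psi]
  split_ifs <;> simp [alphaBlock]

theorem antiABC_mul_alphaBlock (a b : Fin 2) :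
    antiABC d * alphaBlock d a b = if a = 1 then alphaBlock d a b else 0 := by
  rw [mul_alphaBlock]
  simp only [antiABC_mulVec_Psi]
  split_ifs <;> simp [alphaBlock]

theorem alphaBlock_mul_symABC (a b : Fin 2) :
    alphaBlock d a b * symABC d = if b = 0 then alphaBlock d a b else 0 := by
  have := congrArg Matrix.conjTranspose (symABC_mul_alphaBlock (d := d) b a)
  rw [Matrix.conjTranspose_mul, conjTranspose_symABC, conjTranspose_alphaBlock] at this
  rw [this]
  split_ifs <;> simp [conjTranspose_alphaBlock]

theorem alphaBlock_mul_antiABC (a b : Fin 2) :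
    alphaBlock d a b * antiABC d = if b = 1 then alphaBlock d a b else 0 := by
  have := congrArg Matrix.conjTranspose (antiABC_mul_alphaBlock (d := d) b a)
  rw [Matrix.conjTranspose_mul, conjTranspose_antiABC, conjTranspose_alphaBlock] at this
  rw [this]
  split_ifs <;> simp [conjTranspose_alphaBlock]

theorem trace_alphaBlock (hd : 2 ≤ d) (a b : Fin 2) :
    (alphaBlock d a b).trace = if a = b then (d : ℂ) else 0 := by
  simp only [alphaBlock, Matrix.trace_sum, Matrix.trace_vecMulVec, star_Psi, Psi_dotProduct hd]
  by_cases h : a = b <;> simp [h]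

theorem betaProj_eq : betaProj d = symABC d - alphaBlock d 0 0 := rfl

theorem gammaProj_eq : gammaProj d = antiABC d - alphaBlock d 1 1 := rfl

theorem betaProj_mul_alphaBlock (hd : 2 ≤ d) (a b : Fin 2) : betaProj d * alphaBlock d a b = 0 := by
  rw [betaProj_eq, sub_mul, symABC_mul_alphaBlock, alphaBlock_mul_alphaBlock hd]
  fin_cases a <;> simp

theorem gammaProj_mul_alphaBlock (hd : 2 ≤ d) (a b : Fin 2) :
    gammaProj d * alphaBlock d a b = 0 := by
  rw [gammaProj_eq, sub_mul, antiABC_mul_alphaBlock, alphaBlock_mul_alphaBlock hd]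
  fin_cases a <;> simp

theorem alphaBlock_mul_betaProj (hd : 2 ≤ d) (a b : Fin 2) : alphaBlock d a b * betaProj d = 0 := by
  rw [betaProj_eq, mul_sub, alphaBlock_mul_symABC, alphaBlock_mul_alphaBlock hd]
  fin_cases b <;> simp

theorem alphaBlock_mul_gammaProj (hd : 2 ≤ d) (a b : Fin 2) :
    alphaBlock d a b * gammaProj d = 0 := by
  rw [gammaProj_eq, mul_sub, alphaBlock_mul_antiABC, alphaBlock_mul_alphaBlock hd]
  fin_cases b <;> simp

theorem symABC_mul_betaProj : symABC d * betaProj d = betaProj d := by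
  rw [betaProj_eq, mul_sub, symABC_mul_symABC, symABC_mul_alphaBlock]; simp

theorem antiABC_mul_betaProj : antiABC d * betaProj d = 0 := by
  rw [betaProj_eq, mul_sub, antiABC_mul_symABC, antiABC_mul_alphaBlock]; simp

theorem antiABC_mul_gammaProj : antiABC d * gammaProj d = gammaProj d := by
  rw [gammaProj_eq, mul_sub, antiABC_mul_antiABC, antiABC_mul_alphaBlock]; simp

theorem symABC_mul_gammaProj : symABC d * gammaProj d = 0 := by
  rw [gammaProj_eq, mul_sub, symABC_mul_antiABC, symABC_mul_alphaBlock]; simp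

theorem betaProj_mul_betaProj (hd : 2 ≤ d) : betaProj d * betaProj d = betaProj d := by
  conv_lhs => rw [betaProj_eq, sub_mul, ← betaProj_eq]
  rw [symABC_mul_betaProj, alphaBlock_mul_betaProj hd, sub_zero]

theorem gammaProj_mul_gammaProj (hd : 2 ≤ d) : gammaProj d * gammaProj d = gammaProj d := by
  conv_lhs => rw [gammaProj_eq, sub_mul, ← gammaProj_eq]
  rw [antiABC_mul_gammaProj, alphaBlock_mul_gammaProj hd, sub_zero]

theorem betaProj_mul_gammaProj (hd : 2 ≤ d) : betaProj d * gammaProj d = 0 := by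
  rw [betaProj_eq, sub_mul, symABC_mul_gammaProj, alphaBlock_mul_gammaProj hd, sub_zero]

theorem gammaProj_mul_betaProj (hd : 2 ≤ d) : gammaProj d * betaProj d = 0 := by
  rw [gammaProj_eq, sub_mul, antiABC_mul_betaProj, alphaBlock_mul_betaProj hd, sub_zero]

theorem conjTranspose_betaProj : (betaProj d).conjTranspose = betaProj d := by
  rw [betaProj_eq, Matrix.conjTranspose_sub, conjTranspose_symABC, conjTranspose_alphaBlock]

theorem conjTranspose_gammaProj : (gammaProj d).conjTranspose = gammaProj d := by
  rw [gammaProj_eq, Matrix.conjTranspose_sub, conjTranspose_antiABC, conjTranspose_alphaBlock]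

theorem posSemidef_betaProj (hd : 2 ≤ d) : (betaProj d).PosSemidef := by
  have := Matrix.posSemidef_conjTranspose_mul_self (betaProj d)
  rwa [conjTranspose_betaProj, betaProj_mul_betaProj hd] at this

theorem posSemidef_gammaProj (hd : 2 ≤ d) : (gammaProj d).PosSemidef := by
  have := Matrix.posSemidef_conjTranspose_mul_self (gammaProj d)
  rwa [conjTranspose_gammaProj, gammaProj_mul_gammaProj hd] at this

theorem posSemidef_symABC : (symABC d).PosSemidef := by
  have := Matrix.posSemidef_conjTranspose_mul_self (symABC d)
  rwa [conjTranspose_symABC, symABC_mul_symABC] at this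

theorem posSemidef_antiABC : (antiABC d).PosSemidef := by
  have := Matrix.posSemidef_conjTranspose_mul_self (antiABC d)
  rwa [conjTranspose_antiABC, antiABC_mul_antiABC] at this

theorem trace_betaProj (hd : 2 ≤ d) : (betaProj d).trace = d * (d + 2) * (d - 1) / 2 := by
  rw [betaProj_eq, Matrix.trace_sub, trace_symABC, trace_alphaBlock hd, if_pos rfl]
  ring

theorem trace_gammaProj (hd : 2 ≤ d) : (gammaProj d).trace = d * (d - 2) * (d + 1) / 2 := by
  rw [gammaProj_eq, Matrix.trace_sub, trace_antiABC, trace_alphaBlock hd, if_pos rfl]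
  ring

/-- The trace of P^γ has the factor d - 2, and a projection of trace zero vanishes. -/
theorem gammaProj_two : gammaProj 2 = 0 := by
  have h := trace_gammaProj (d := 2) le_rfl
  have h2 := gammaProj_mul_gammaProj (d := 2) le_rfl
  rw [← Matrix.trace_conjTranspose_mul_self_eq_zero_iff, conjTranspose_gammaProj, h2, h]
  norm_num

/-- `P^α ⊗ |v⟩⟨v|` for a real vector `v`. -/
def alphaForm (d : ℕ) (v : Fin 2 → ℝ) : Matrix (ABC d) (ABC d) ℂ :=
  ∑ a, ∑ b, ((v a * v b : ℝ) : ℂ) • alphaBlock d a b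

theorem alphaForm_eq_sum (v : Fin 2 → ℝ) : alphaForm d v = ∑ m,
    Matrix.vecMulVec (∑ a, (v a : ℂ) • Psi d a m) (star (∑ a, (v a : ℂ) • Psi d a m)) := by
  simp only [alphaForm, alphaBlock, Fin.sum_univ_two, Finset.smul_sum, ← Finset.sum_add_distrib]
  refine Finset.sum_congr rfl fun m _ => ?_
  ext x y
  simp [Matrix.vecMulVec_apply]
  ring

theorem posSemidef_alphaForm (v : Fin 2 → ℝ) : (alphaForm d v).PosSemidef := by
  rw [alphaForm_eq_sum]
  exact Matrix.posSemidef_sum _ fun m _ => Matrix.posSemidef_vecMulVec_self_star _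

/-- Since √((d±1)/2) Ψ^±_m is half the sum or difference of the two ω-vectors, these square roots
are the coordinates of an ω-vector in the basis Ψ^±_m; exchanging A and B flips the second sign. -/
theorem omegaOp_self (hd : 2 ≤ d) (r : Fin 2) : omegaOp d r r =
    alphaForm d ![√((d + 1) / 2), sgn r * √((d - 1) / 2)] := by
  rw [alphaForm_eq_sum, omegaOp]
  have hv : ∀ m, ∑ a, ((![√(((d : ℝ) + 1) / 2), sgn r * √((d - 1) / 2)] a : ℝ) : ℂ) • Psi d a m =
      omegaVec d r m := by
    intro m
    have h0 : ((√(((d : ℝ) + 1) / 2) : ℝ) : ℂ) * psiNorm d 0 = 1 / 2 := by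
      rw [← Complex.ofReal_mul, show (d : ℝ) + 1 = d + sgn 0 from rfl,
        sqrt_half_mul_psiNorm hd 0]
      norm_num
    have h1 : ((√(((d : ℝ) - 1) / 2) : ℝ) : ℂ) * psiNorm d 1 = 1 / 2 := by
      rw [← Complex.ofReal_mul, show (d : ℝ) - 1 = d + sgn 1 from sub_eq_add_neg _ _,
        sqrt_half_mul_psiNorm hd 1]
      norm_num
    simp only [Fin.sum_univ_two, Psi_eq, Matrix.cons_val_zero, Matrix.cons_val_one, smul_smul,
      Complex.ofReal_mul, mul_assoc, h0, h1]
    fin_cases r <;> simp <;> module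
  simp only [hv]

end algebra

/-! ### The fidelity as a linear functional of the diagonal blocks -/

section fidelity

variable {d : ℕ}

/-- The diagonal block of an operator on all wires at the value `k` of `D`. -/
def wireBlock (R : Matrix (Wires d) (Wires d) ℂ) (k : Fin d) : Matrix (ABC d) (ABC d) ℂ :=
  R.submatrix (fun x => (x.1, (k, x.2))) (fun x => (x.1, (k, x.2)))

/-- The operator `E_iᵀ ⊗ E_jᵀ ⊗ E_k` on `A ⊗ B ⊗ C`. -/
def tripleProj (U : SU d) (i j k : Fin d) : Matrix (ABC d) (ABC d) ℂ :=
  ((vonNeumann U i).transpose ⊗ₖ (vonNeumann U j).transpose) ⊗ₖ vonNeumann U k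

theorem choi_measureAndPrepare_apply (E : Fin d → Matrix (Fin d) (Fin d) ℂ) (k c k' c' : Fin d) :
    choi (measureAndPrepare E) (k, c) (k', c') = if k = k' then E k c' c else 0 := by
  simp only [choi, measureAndPrepare, Matrix.trace_mul_single, Matrix.sum_apply,
    Matrix.kroneckerMap_apply, Matrix.smul_apply, Matrix.single_apply, smul_eq_mul]
  by_cases h : k = k' <;> simp [h, ite_and]

theorem partialTrace_smul {X K : Type*} [Fintype K] (c : ℂ) (R : Matrix (X × K) (X × K) ℂ) :
    partialTrace (c • R) = c • partialTrace R := by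
  ext x y
  simp [partialTrace, Finset.mul_sum]

theorem partialTrace_add {X K : Type*} [Fintype K] (R S : Matrix (X × K) (X × K) ℂ) :
    partialTrace (R + S) = partialTrace R + partialTrace S := by
  ext x y
  simp [partialTrace, Finset.sum_add_distrib]

theorem trace_partialTrace_mul {X K : Type*} [Fintype X] [Fintype K] [DecidableEq K]
    (R : Matrix (X × K) (X × K) ℂ) (Z : Matrix X X ℂ) :
    (partialTrace R * Z).trace = (R * (Z ⊗ₖ 1)).trace := by
  simp only [Matrix.trace, Matrix.diag, Matrix.mul_apply, partialTrace, Matrix.of_apply,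
    Fintype.sum_prod_type, Matrix.kroneckerMap_apply, Matrix.one_apply, Finset.sum_mul]
  refine Finset.sum_congr rfl fun x _ => ?_
  rw [Finset.sum_comm]
  simp

/-- The inserted channel emits a classical outcome, so its Choi operator is block diagonal in `D`
and selects only the diagonal blocks of R. -/
theorem link_choi (R : Matrix (Wires d) (Wires d) ℂ) (E : Fin d → Matrix (Fin d) (Fin d) ℂ) :
    link R (choi (measureAndPrepare E)) =
      ∑ k, partialTrace (wireBlock R k * ((1 : Matrix (Fin d × Fin d) _ ℂ) ⊗ₖ E k)) := by
  have e1 : ∀ f : Wires d → ℂ, ∑ q, f q = ∑ y, ∑ k, ∑ c, f (y, (k, c)) := fun f => by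
    rw [Fintype.sum_prod_type]
    exact Finset.sum_congr rfl fun _ _ => Fintype.sum_prod_type _
  have e2 : ∀ f : ABC d → ℂ, ∑ q, f q = ∑ y, ∑ c, f (y, c) := fun f => Fintype.sum_prod_type _
  ext x y
  simp only [link, partialTrace, Matrix.mul_apply, partialTranspose, Matrix.of_apply,
    Matrix.sum_apply, Matrix.kroneckerMap_apply, wireBlock, Matrix.submatrix_apply, e1, e2,
    Matrix.one_apply, Fintype.sum_prod_type (f := fun q : Fin d × Fin d => ∑ _, ∑ _, ∑ _, _),
    choi_measureAndPrepare_apply]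
  simp only [ite_mul, one_mul, zero_mul, mul_ite, mul_zero, Finset.sum_ite_irrel,
    Finset.sum_const_zero, Finset.sum_ite_eq', Finset.mem_univ, if_true]
  exact Finset.sum_congr rfl fun k _ => Finset.sum_comm

theorem trace_replicated_mul (R : Fin d → Fin d → Matrix (Wires d) (Wires d) ℂ) (U : SU d)
    (i j : Fin d) : (replicated R U i j * (vonNeumann U i ⊗ₖ vonNeumann U j)).trace =
      ∑ k, (wireBlock (R i j) k * tripleProj U i j k).trace := by
  rw [replicated, link_choi, ← Matrix.trace_transpose, Matrix.transpose_mul,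
    Matrix.transpose_transpose, Matrix.trace_mul_comm, Finset.sum_mul, Matrix.trace_sum]
  refine Finset.sum_congr rfl fun k _ => ?_
  rw [trace_partialTrace_mul, Matrix.mul_assoc, ← Matrix.mul_kronecker_mul, Matrix.one_mul,
    Matrix.mul_one, ← Matrix.kroneckerMap_transpose]
  rfl

theorem cloneFidelityAt_eq (R : Fin d → Fin d → Matrix (Wires d) (Wires d) ℂ) (U : SU d) :
    cloneFidelityAt R U = 1 / (d : ℝ) ^ 2 *
      ∑ i, ∑ j, ∑ k, ((wireBlock (R i j) k * tripleProj U i j k).trace).re := by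
  rw [cloneFidelityAt, povmFidelity, Fintype.card_prod, Fintype.card_fin, Fintype.sum_prod_type]
  simp only [trace_replicated_mul, Complex.re_sum]
  push_cast
  rw [sq]

theorem continuous_tripleProj (i j k : Fin d) : Continuous fun U => tripleProj U i j k :=
  continuous_pi fun _ => continuous_pi fun _ =>
    (((continuous_vonNeumann i).matrix_elem _ _).mul
      ((continuous_vonNeumann j).matrix_elem _ _)).mul ((continuous_vonNeumann k).matrix_elem _ _)

theorem continuous_trace_mul_tripleProj (X : Matrix (ABC d) (ABC d) ℂ) (i j k : Fin d) :
    Continuous fun U => (X * tripleProj U i j k).trace :=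
  (continuous_const.matrix_mul (continuous_tripleProj i j k)).matrix_trace

theorem continuous_cloneFidelityAt (R : Fin d → Fin d → Matrix (Wires d) (Wires d) ℂ) :
    Continuous (cloneFidelityAt R) := by
  have : cloneFidelityAt R = fun U => 1 / (d : ℝ) ^ 2 *
      ∑ i, ∑ j, ∑ k, ((wireBlock (R i j) k * tripleProj U i j k).trace).re :=
    funext (cloneFidelityAt_eq R)
  rw [this]
  exact continuous_const.mul (continuous_finsetSum _ fun i _ => continuous_finsetSum _ fun j _ =>
    continuous_finsetSum _ fun k _ =>
      Complex.continuous_re.comp (continuous_trace_mul_tripleProj _ i j k))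

/-- The Haar average of `E_iᵀ ⊗ E_jᵀ ⊗ E_k`. -/
def avgTriple (i j k : Fin d) : Matrix (ABC d) (ABC d) ℂ := haarAvg fun U => tripleProj U i j k

theorem cloneFidelity_eq (R : Fin d → Fin d → Matrix (Wires d) (Wires d) ℂ) :
    cloneFidelity R = 1 / (d : ℝ) ^ 2 *
      ∑ i, ∑ j, ∑ k, ((wireBlock (R i j) k * avgTriple i j k).trace).re := by
  have hint : ∀ i j k, Integrable
      (fun U => ((wireBlock (R i j) k * tripleProj U i j k).trace).re) (haarSU d) := fun i j k =>
    Continuous.integrable_haarSU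
      (Complex.continuous_re.comp (continuous_trace_mul_tripleProj _ i j k))
  simp only [cloneFidelity, cloneFidelityAt_eq]
  rw [integral_const_mul, integral_finsetSum _ fun i _ => integrable_finsetSum _ fun j _ =>
    integrable_finsetSum _ fun k _ => hint i j k]
  congr 1
  refine Finset.sum_congr rfl fun i _ => ?_
  rw [integral_finsetSum _ fun j _ => integrable_finsetSum _ fun k _ => hint i j k]
  refine Finset.sum_congr rfl fun j _ => ?_
  rw [integral_finsetSum _ fun k _ => hint i j k]
  refine Finset.sum_congr rfl fun k _ => ?_
  rw [avgTriple, ← integral_trace_const_mul _ (continuous_tripleProj i j k)]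
  exact integral_re (Continuous.integrable_haarSU (continuous_trace_mul_tripleProj _ i j k))

theorem wireBlock_sum {ι : Type*} (s : Finset ι) (R : ι → Matrix (Wires d) (Wires d) ℂ)
    (k : Fin d) : wireBlock (∑ i ∈ s, R i) k = ∑ i ∈ s, wireBlock (R i) k := by
  ext x y
  simp [wireBlock, Matrix.sum_apply]

theorem wireBlock_tensorD (M : Matrix (Fin d) (Fin d) ℂ) (S : Matrix (ABC d) (ABC d) ℂ)
    (k : Fin d) : wireBlock (tensorD M S) k = M k k • S := by
  ext x y
  simp [wireBlock, tensorD]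

theorem posSemidef_wireBlock {R : Matrix (Wires d) (Wires d) ℂ} (hR : R.PosSemidef) (k : Fin d) :
    (wireBlock R k).PosSemidef :=
  hR.submatrix _

theorem posSemidef_tripleProj (U : SU d) (i j k : Fin d) : (tripleProj U i j k).PosSemidef :=
  ((posSemidef_vonNeumann U i).transpose.kronecker (posSemidef_vonNeumann U j).transpose).kronecker
    (posSemidef_vonNeumann U k)

theorem sum_tripleProj_right (U : SU d) (i j : Fin d) : ∑ k, tripleProj U i j k =
    ((vonNeumann U i).transpose ⊗ₖ (vonNeumann U j).transpose) ⊗ₖ 1 := by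
  rw [← sum_vonNeumann U]
  ext x y
  simp [tripleProj, Matrix.sum_apply, Finset.mul_sum]

theorem sum_tripleProj_middle (U : SU d) (i k : Fin d) : ∑ j, tripleProj U i j k =
    ((vonNeumann U i).transpose ⊗ₖ 1) ⊗ₖ vonNeumann U k := by
  rw [show (1 : Matrix (Fin d) (Fin d) ℂ) = (∑ j, vonNeumann U j).transpose by
    rw [sum_vonNeumann, Matrix.transpose_one]]
  ext x y
  simp [tripleProj, Matrix.sum_apply, Finset.mul_sum, Finset.sum_mul]

theorem tripleProj_mulVec_omegaVec_zero (U : SU d) (i j k m : Fin d) (x : ABC d) :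
    (tripleProj U i j k).mulVec (omegaVec d 0 m) x =
      (vonNeumann U k * vonNeumann U i) x.2 x.1.1 * vonNeumann U j m x.1.2 := by
  simp [tripleProj, Matrix.mulVec, dotProduct, Fintype.sum_prod_type, omegaVec, ite_and,
    Matrix.mul_apply, Finset.sum_mul]
  refine Finset.sum_congr rfl fun _ _ => ?_
  ring

theorem tripleProj_mulVec_omegaVec_one (U : SU d) (i j k m : Fin d) (x : ABC d) :
    (tripleProj U i j k).mulVec (omegaVec d 1 m) x =
      (vonNeumann U k * vonNeumann U j) x.2 x.1.2 * vonNeumann U i m x.1.1 := by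
  simp [tripleProj, Matrix.mulVec, dotProduct, Fintype.sum_prod_type, omegaVec, ite_and,
    Matrix.mul_apply, Finset.sum_mul]
  refine Finset.sum_congr rfl fun _ _ => ?_
  ring

/-- Contracting ω_{AC} with E_iᵀ ⊗ E_k produces E_k E_i, and ω_{BC} likewise produces E_k E_j; both
products vanish by orthogonality. -/
theorem tripleProj_mul_alphaBlock_eq_zero (U : SU d) {i j k : Fin d} (hi : k ≠ i) (hj : k ≠ j)
    (a b : Fin 2) : tripleProj U i j k * alphaBlock d a b = 0 := by
  have h : ∀ m, (tripleProj U i j k).mulVec (Psi d a m) = 0 := by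
    intro m
    funext x
    simp [Psi_eq, Matrix.mulVec_smul, Matrix.mulVec_add, tripleProj_mulVec_omegaVec_zero,
      tripleProj_mulVec_omegaVec_one, vonNeumann_mul_vonNeumann, hi, hj]
  simp [mul_alphaBlock, h]

theorem tripleProj_self_mul_antiABC (U : SU d) (i k : Fin d) :
    tripleProj U i i k * antiABC d = 0 := by
  rw [tripleProj, ← Matrix.mul_kronecker_mul]
  have : ((vonNeumann U i).transpose ⊗ₖ (vonNeumann U i).transpose) * antiProj d = 0 := by
    rw [antiProj, mul_smul_comm, mul_sub, mul_one, sub_eq_zero.2, smul_zero]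
    ext x y
    simp [Matrix.mul_apply, swapAB, Fintype.sum_prod_type, Prod.ext_iff, ite_and, vonNeumann_apply]
    ring
  rw [this, Matrix.zero_kronecker]

/-- The value `Tr[(E_iᵀ ⊗ E_jᵀ ⊗ E_k) ∑_m |χ^r_m⟩⟨χ^s_m|]`. -/
theorem trace_tripleProj_mul_omegaOp (U : SU d) (i j k : Fin d) (r s : Fin 2) :
    (tripleProj U i j k * omegaOp d r s).trace =
      if r = s then (if r = 0 then (if k = i then 1 else 0) else (if k = j then 1 else 0))
      else (if k = i ∧ k = j then 1 else 0) := by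
  have h : (tripleProj U i j k * omegaOp d r s).trace =
      ∑ m, (tripleProj U i j k).mulVec (omegaVec d r m) ⬝ᵥ omegaVec d s m := by
    simp [omegaOp, Matrix.mul_sum, Matrix.mul_vecMulVec, Matrix.trace_sum, Matrix.trace_vecMulVec,
      star_omegaVec]
  have htr : ∀ i, ∑ a, vonNeumann U i a a = 1 := fun i => trace_vonNeumann U i
  have hpr : ∀ i j, ∑ m, ∑ x, vonNeumann U i x m * vonNeumann U j m x = if i = j then 1 else 0 := by
    intro i j
    have := congrArg Matrix.trace (vonNeumann_mul_vonNeumann U i j)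
    rw [Finset.sum_comm]
    simp only [Matrix.trace, Matrix.diag, Matrix.mul_apply] at this
    rw [this]
    split_ifs
    · exact htr i
    · simp
  rw [h]
  fin_cases r <;> fin_cases s <;>
    simp [tripleProj_mulVec_omegaVec_zero, tripleProj_mulVec_omegaVec_one, dotProduct,
      Fintype.sum_prod_type, omegaVec, ite_and, vonNeumann_mul_vonNeumann]
  · by_cases hi : k = i <;> simp [hi, htr, ← Finset.sum_mul]
  · by_cases hi : k = i <;> simp [hi, hpr]
  · by_cases hj : k = j <;> simp [hj, hpr]
  · by_cases hj : k = j <;> simp [hj, htr, ← Finset.sum_mul]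

end fidelity

/-! ### Averages of the three-fold tensor products -/

section averages

variable {d : ℕ}

theorem sum_eq_add_smul_of_forall_ne {V : Type*} [AddCommGroup V] [Module ℂ V] (f : Fin d → V)
    (i : Fin d) {v : V} (hv : ∀ k, k ≠ i → f k = v) : ∑ k, f k = f i + ((d : ℂ) - 1) • v := by
  have hd : 1 ≤ d := Nat.one_le_iff_ne_zero.2 fun h => (Fin.cast h i).elim0
  rw [← Finset.add_sum_erase _ _ (Finset.mem_univ i),
    Finset.sum_congr rfl fun k hk => hv k (Finset.ne_of_mem_erase hk), Finset.sum_const,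
    Finset.card_erase_of_mem (Finset.mem_univ i), Finset.card_univ, Fintype.card_fin,
    ← Nat.cast_smul_eq_nsmul ℂ, Nat.cast_sub hd, Nat.cast_one]

theorem sum_eq_add_add_smul_of_forall_ne {V : Type*} [AddCommGroup V] [Module ℂ V]
    (f : Fin d → V) {i j : Fin d} (hij : i ≠ j) {v : V} (hv : ∀ k, k ≠ i → k ≠ j → f k = v) :
    ∑ k, f k = f i + f j + ((d : ℂ) - 2) • v := by
  -- Replacing the value at j by v leaves i as the only exceptional index.
  have h := sum_eq_add_smul_of_forall_ne (fun k => f k + if k = j then v - f j else 0) i (v := v)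
    (by
      intro k hk
      by_cases hkj : k = j
      · simp [hkj]
      · simp [hkj, hv k hk hkj])
  rw [Finset.sum_add_distrib] at h
  simp only [Finset.sum_ite_eq', Finset.mem_univ, if_true, hij, if_false, add_zero] at h
  rw [eq_sub_of_add_eq h]
  module

/-- This makes the average depend only on the equality pattern of the indices, so sums over one
index determine individual terms. -/
theorem avgTriple_perm (π : Equiv.Perm (Fin d)) (i j k : Fin d) :
    avgTriple (π i) (π j) (π k) = avgTriple i j k := by
  have hd : d ≠ 0 := fun h => (Fin.cast h i).elim0
  ext x y
  exact integral_perm_vonNeumann hd π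
    (fun E => (((E i).transpose ⊗ₖ (E j).transpose) ⊗ₖ E k) x y)

theorem posSemidef_avgTriple (i j k : Fin d) : (avgTriple i j k).PosSemidef :=
  posSemidef_haarAvg (continuous_tripleProj i j k) fun U => posSemidef_tripleProj U i j k

theorem omegaOp_zero_apply (x y : ABC d) : omegaOp d 0 0 x y =
    if x.1.1 = x.2 ∧ y.1.1 = y.2 ∧ x.1.2 = y.1.2 then 1 else 0 := by
  simp [omegaOp, omegaVec, Matrix.sum_apply, Matrix.vecMulVec_apply, ite_and]
  split_ifs <;> simp_all [eq_comm]

theorem omegaOp_one_apply (x y : ABC d) : omegaOp d 1 1 x y =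
    if x.1.2 = x.2 ∧ y.1.2 = y.2 ∧ x.1.1 = y.1.1 then 1 else 0 := by
  simp [omegaOp, omegaVec, Matrix.sum_apply, Matrix.vecMulVec_apply, ite_and]
  split_ifs <;> simp_all [eq_comm]

theorem integral_vonNeumann_mul (i a a' b b' : Fin d) :
    ∫ U, vonNeumann U i a a' * vonNeumann U i b b' ∂(haarSU d) =
      ((if a = a' ∧ b = b' then 1 else 0) + (if a = b' ∧ b = a' then 1 else 0)) /
        (d * (d + 1)) :=
  haarAvg_vonNeumann_kronecker_self i a b a' b'

theorem sum_avgTriple_self (i : Fin d) :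
    ∑ k, avgTriple i i k = (2 / (d * (d + 1)) : ℂ) • symABC d := by
  simp only [avgTriple]
  rw [← haarAvg_sum _ fun k => continuous_tripleProj i i k]
  ext ⟨⟨a, b⟩, c⟩ ⟨⟨a', b'⟩, c'⟩
  simp only [sum_tripleProj_right, haarAvg, Matrix.of_apply, Matrix.kroneckerMap_apply,
    Matrix.transpose_apply, integral_mul_const, integral_vonNeumann_mul]
  simp [symProj, swapAB, Matrix.one_apply, Prod.ext_iff, eq_comm]
  by_cases hc : c = c'
  · simp only [hc, if_true, and_comm (a := b = a')]; ring
  · simp [hc]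

/-- Summing over j replaces the middle factor by the identity. What remains is the second moment
partially transposed on A, which keeps the identity and turns the swap of A and C into |ω⟩⟨ω|_{AC}.
-/
theorem sum_avgTriple_middle (i : Fin d) :
    ∑ j, avgTriple i j i = (1 / (d * (d + 1)) : ℂ) • (1 + omegaOp d 0 0) := by
  simp only [avgTriple]
  rw [← haarAvg_sum _ fun j => continuous_tripleProj i j i]
  ext ⟨⟨a, b⟩, c⟩ ⟨⟨a', b'⟩, c'⟩
  simp only [sum_tripleProj_middle, haarAvg, Matrix.of_apply, Matrix.kroneckerMap_apply,
    Matrix.transpose_apply, mul_right_comm _ _ (vonNeumann _ _ _ _), integral_mul_const,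
    integral_vonNeumann_mul]
  simp [omegaOp_zero_apply, Matrix.one_apply, Prod.ext_iff, eq_comm]
  by_cases hb : b = b'
  · simp only [hb, and_true, if_true, and_comm (a := c = a)]; field_simp
  · simp [hb]

theorem sum_tripleProj_left (U : SU d) (j k : Fin d) : ∑ i, tripleProj U i j k =
    ((1 : Matrix (Fin d) (Fin d) ℂ) ⊗ₖ (vonNeumann U j).transpose) ⊗ₖ vonNeumann U k := by
  rw [show (1 : Matrix (Fin d) (Fin d) ℂ) = (∑ j, vonNeumann U j).transpose by
    rw [sum_vonNeumann, Matrix.transpose_one]]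
  ext x y
  simp [tripleProj, Matrix.sum_apply, Finset.sum_mul]

theorem sum_avgTriple_left (j : Fin d) :
    ∑ i, avgTriple i j j = (1 / (d * (d + 1)) : ℂ) • (1 + omegaOp d 1 1) := by
  simp only [avgTriple]
  rw [← haarAvg_sum _ fun i => continuous_tripleProj i j j]
  ext ⟨⟨a, b⟩, c⟩ ⟨⟨a', b'⟩, c'⟩
  simp only [sum_tripleProj_left, haarAvg, Matrix.of_apply, Matrix.kroneckerMap_apply,
    Matrix.transpose_apply, mul_assoc, integral_const_mul, integral_vonNeumann_mul]
  simp [omegaOp_one_apply, Matrix.one_apply, Prod.ext_iff, eq_comm]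
  by_cases ha : a = a'
  · simp only [ha, and_true, true_and, if_true, and_comm (a := c = b)]; field_simp
  · simp [ha]

theorem sum_sum_avgTriple (i : Fin d) :
    ∑ j, ∑ k, avgTriple i j k = (1 / d : ℂ) • (1 : Matrix (ABC d) (ABC d) ℂ) := by
  have hd : (d : ℂ) ≠ 0 := Nat.cast_ne_zero.2 fun h => (Fin.cast h i).elim0
  have hd1 : (d : ℂ) + 1 ≠ 0 := by exact_mod_cast d.succ_ne_zero
  have hfirst : ∀ a a', ∫ U, vonNeumann U i a a' ∂(haarSU d) = if a = a' then (1 / d : ℂ) else 0 := by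
    intro a a'
    -- Inserting Tr E_i = 1 reduces the first moment to the second.
    have h : ∀ U : SU d, vonNeumann U i a a' = ∑ b, vonNeumann U i a a' * vonNeumann U i b b := by
      intro U
      have := trace_vonNeumann U i
      simp only [Matrix.trace, Matrix.diag] at this
      rw [← Finset.mul_sum, this, mul_one]
    have hint : ∀ b, Integrable (fun U => vonNeumann U i a a' * vonNeumann U i b b) (haarSU d) :=
      fun b => Continuous.integrable_haarSU
        (((continuous_vonNeumann i).matrix_elem a a').mul
          ((continuous_vonNeumann i).matrix_elem b b))
    rw [integral_congr_ae (ae_of_all _ h), integral_finsetSum _ fun b _ => hint b]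
    simp only [integral_vonNeumann_mul, ← Finset.sum_div, Finset.sum_add_distrib]
    by_cases haa : a = a'
    · simp [haa, ite_and]
      field_simp
    · have : ∀ b, ¬ (a = b ∧ b = a') := fun b h => haa (h.1.trans h.2)
      simp [haa, this]
  have hcont : ∀ j, Continuous fun U : SU d => ∑ k, tripleProj U i j k := fun j =>
    continuous_finsetSum _ fun k _ => continuous_tripleProj i j k
  simp only [avgTriple]
  simp_rw [← haarAvg_sum _ fun k => continuous_tripleProj i _ k]
  rw [← haarAvg_sum _ hcont]
  have h : ∀ U : SU d, ∑ j, ∑ k, tripleProj U i j k =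
      ((vonNeumann U i).transpose ⊗ₖ (1 : Matrix (Fin d) (Fin d) ℂ)) ⊗ₖ
        (1 : Matrix (Fin d) (Fin d) ℂ) := by
    intro U
    simp only [sum_tripleProj_right]
    ext x y
    have h1 := congrFun (congrFun (sum_vonNeumann U) y.1.2) x.1.2
    rw [Matrix.sum_apply] at h1
    simp [Matrix.sum_apply, ← Finset.mul_sum, h1, Matrix.one_apply,
      eq_comm (a := y.1.2)]
  simp only [h]
  ext ⟨⟨a, b⟩, c⟩ ⟨⟨a', b'⟩, c'⟩
  simp only [haarAvg, Matrix.of_apply, Matrix.kroneckerMap_apply,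
    Matrix.transpose_apply, integral_mul_const, hfirst]
  simp [Matrix.one_apply, Prod.ext_iff, eq_comm, ite_and]
  split_ifs <;> rfl

theorem avgTriple_mul_eq_zero (X : Matrix (ABC d) (ABC d) ℂ) {i j k : Fin d}
    (h : ∀ U : SU d, tripleProj U i j k * X = 0) : avgTriple i j k * X = 0 := by
  rw [avgTriple, ← haarAvg_mul_const X (continuous_tripleProj i j k)]
  simp only [h]
  exact haarAvg_const 0

end averages

/-! ### The dual bound -/

section bound

variable {d : ℕ}

/-- A dual feasible operator for the optimization of the cloning fidelity. -/
def dualOp (d : ℕ) : Matrix (ABC d) (ABC d) ℂ :=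
  ((2 / (d * (d + 1)) : ℝ) : ℂ) • symABC d + ((2 / (3 * d * (d - 1)) : ℝ) : ℂ) • antiABC d

theorem PosSemidef.ofReal_smul {n : Type*} {X : Matrix n n ℂ} (hX : X.PosSemidef) {r : ℝ}
    (hr : 0 ≤ r) : ((r : ℂ) • X).PosSemidef :=
  hX.smul (Complex.zero_le_real.2 hr)

/-- The part of `P^+ ⊗ I` left after removing the average of `E_iᵀ ⊗ E_iᵀ ⊗ E_i`. -/
def avgRest (i : Fin d) : Matrix (ABC d) (ABC d) ℂ := ∑ k ∈ Finset.univ.erase i, avgTriple i i k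

theorem avgTriple_self_add_avgRest (i : Fin d) :
    avgTriple i i i + avgRest i = ((2 / (d * (d + 1)) : ℝ) : ℂ) • symABC d := by
  rw [avgRest, Finset.add_sum_erase _ _ (Finset.mem_univ i), sum_avgTriple_self]
  push_cast; rfl

theorem posSemidef_avgRest (i : Fin d) : (avgRest i).PosSemidef :=
  Matrix.posSemidef_sum _ fun k _ => posSemidef_avgTriple i i k

/-- The terms with k ≠ i annihilate P^α, and equal indices on A and B annihilate P⁻; only P^β
remains. -/
theorem avgRest_mul_betaProj (i : Fin d) : avgRest i * betaProj d = avgRest i := by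
  have h1 : avgRest i * alphaBlock d 0 0 = 0 := by
    rw [avgRest, Finset.sum_mul]
    refine Finset.sum_eq_zero fun k hk => avgTriple_mul_eq_zero _ fun U => ?_
    exact tripleProj_mul_alphaBlock_eq_zero U (Finset.ne_of_mem_erase hk)
      (Finset.ne_of_mem_erase hk) 0 0
  have h2 : avgRest i * antiABC d = 0 := by
    rw [avgRest, Finset.sum_mul]
    exact Finset.sum_eq_zero fun k _ => avgTriple_mul_eq_zero _ fun U =>
      tripleProj_self_mul_antiABC U i k
  rw [betaProj_eq, eq_sub_of_add_eq (symABC_add_antiABC (d := d)), mul_sub, mul_sub, mul_one, h1,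
    h2, sub_zero, sub_zero]

/-- This is the compression of the positive average of E_iᵀ ⊗ E_iᵀ ⊗ E_i by P^β: the two averages
add up to a multiple of P⁺ ⊗ I, and the remainder already lives on P^β. -/
theorem posSemidef_betaProj_sub_avgRest (hd : 2 ≤ d) (i : Fin d) :
    (((2 / (d * (d + 1)) : ℝ) : ℂ) • betaProj d - avgRest i).PosSemidef := by
  have h := (posSemidef_avgTriple i i i).mul_mul_conjTranspose_same (betaProj d)
  have hr : betaProj d * avgRest i = avgRest i := by
    have := congrArg Matrix.conjTranspose (avgRest_mul_betaProj i)
    rwa [Matrix.conjTranspose_mul, conjTranspose_betaProj, (posSemidef_avgRest i).1.eq] at this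
  have hs : betaProj d * symABC d = betaProj d := by
    have := congrArg Matrix.conjTranspose (symABC_mul_betaProj (d := d))
    rwa [Matrix.conjTranspose_mul, conjTranspose_betaProj, conjTranspose_symABC] at this
  rw [conjTranspose_betaProj, eq_sub_of_add_eq (avgTriple_self_add_avgRest i), mul_sub, sub_mul,
    hr, avgRest_mul_betaProj, mul_smul_comm, smul_mul_assoc,
    hs, betaProj_mul_betaProj hd] at h
  exact h

theorem alphaForm_two (a b : ℝ) : alphaForm d ![a, b] =
    ((a * a : ℝ) : ℂ) • alphaBlock d 0 0 + ((a * b : ℝ) : ℂ) • (alphaBlock d 0 1 + alphaBlock d 1 0) +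
      ((b * b : ℝ) : ℂ) • alphaBlock d 1 1 := by
  simp [alphaForm, Fin.sum_univ_two]
  module

/-- The added block is the α part of the average with three equal indices. The weight 2/(3d(d-1)) of
P⁻ in the dual operator is tuned so that the 2 × 2 α component here becomes singular, hence a
rank-one form. -/
theorem smul_dualOp_sub (hd : 2 ≤ d) (r : Fin 2) :
    ((d - 1 : ℝ) : ℂ) • dualOp d - ((1 / (d * (d + 1)) : ℝ) : ℂ) • (1 + omegaOp d r r) +
      ((2 / (d * (d + 1)) : ℝ) : ℂ) • alphaBlock d 0 0 =
    (((2 * d - 3) / (d * (d + 1)) : ℝ) : ℂ) • betaProj d +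
      (((2 * d - 1) / (3 * d * (d + 1)) : ℝ) : ℂ) • gammaProj d +
      ((1 / (3 * d * (d + 1)) : ℝ) : ℂ) •
        alphaForm d ![3 * √((d - 1) / 2), - sgn r * √((d + 1) / 2)] := by
  have hd' : (2 : ℝ) ≤ d := by exact_mod_cast hd
  have h1 : √(((d : ℝ) - 1) / 2) * √((d - 1) / 2) = (d - 1) / 2 :=
    Real.mul_self_sqrt (by linarith)
  have h2 : √(((d : ℝ) + 1) / 2) * √((d + 1) / 2) = (d + 1) / 2 :=
    Real.mul_self_sqrt (by linarith)
  have hs : sgn r * sgn r = 1 := by fin_cases r <;> simp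
  rw [omegaOp_self hd, alphaForm_two, alphaForm_two, dualOp, ← symABC_add_antiABC, betaProj_eq,
    gammaProj_eq, h2,
    show sgn r * √(((d : ℝ) - 1) / 2) * (sgn r * √((d - 1) / 2)) = (d - 1) / 2 by
      linear_combination (sgn r * sgn r) * h1 + ((d : ℝ) - 1) / 2 * hs,
    show 3 * √(((d : ℝ) - 1) / 2) * (3 * √((d - 1) / 2)) = 9 * (d - 1) / 2 by
      linear_combination 9 * h1,
    show - sgn r * √(((d : ℝ) + 1) / 2) * (- sgn r * √((d + 1) / 2)) = (d + 1) / 2 by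
      linear_combination (sgn r * sgn r) * h2 + ((d : ℝ) + 1) / 2 * hs]
  have hd0 : (d : ℂ) ≠ 0 := by exact_mod_cast (by omega : d ≠ 0)
  have hd1 : (d : ℂ) + 1 ≠ 0 := by exact_mod_cast d.succ_ne_zero
  have hdm : (d : ℂ) - 1 ≠ 0 := by
    have : (d : ℝ) - 1 ≠ 0 := by linarith
    exact_mod_cast this
  match_scalars <;> field_simp <;> ring

theorem posSemidef_smul_dualOp_sub (hd : 2 ≤ d) (r : Fin 2) (i : Fin d) :
    (((d - 1 : ℝ) : ℂ) • dualOp d - (((1 / (d * (d + 1)) : ℝ) : ℂ) • (1 + omegaOp d r r) -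
      avgTriple i i i)).PosSemidef := by
  have hd' : (2 : ℝ) ≤ d := by exact_mod_cast hd
  have h : ((d - 1 : ℝ) : ℂ) • dualOp d - (((1 / (d * (d + 1)) : ℝ) : ℂ) • (1 + omegaOp d r r) -
      avgTriple i i i) = (((2 * d - 3) / (d * (d + 1)) : ℝ) : ℂ) • betaProj d +
      (((2 * d - 1) / (3 * d * (d + 1)) : ℝ) : ℂ) • gammaProj d +
      ((1 / (3 * d * (d + 1)) : ℝ) : ℂ) •
        alphaForm d ![3 * √((d - 1) / 2), - sgn r * √((d + 1) / 2)] +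
      (((2 / (d * (d + 1)) : ℝ) : ℂ) • betaProj d - avgRest i) := by
    rw [← smul_dualOp_sub hd r, eq_sub_of_add_eq (avgTriple_self_add_avgRest i), betaProj_eq]
    module
  rw [h]
  refine (((PosSemidef.ofReal_smul (posSemidef_betaProj hd) ?_).add
    (PosSemidef.ofReal_smul (posSemidef_gammaProj hd) ?_)).add
    (PosSemidef.ofReal_smul (posSemidef_alphaForm _) ?_)).add (posSemidef_betaProj_sub_avgRest hd i)
  · exact div_nonneg (by linarith) (by positivity)
  · exact div_nonneg (by linarith) (by positivity)
  · positivity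

theorem smul_avgTriple_left {i j : Fin d} (hij : i ≠ j) :
    ((d - 1 : ℝ) : ℂ) • avgTriple i j i =
      ((1 / (d * (d + 1)) : ℝ) : ℂ) • (1 + omegaOp d 0 0) - avgTriple i i i := by
  have h := sum_eq_add_smul_of_forall_ne (fun j => avgTriple i j i) i (v := avgTriple i j i) (by
    intro k hk
    have := avgTriple_perm (Equiv.swap k j) i k i
    rwa [Equiv.swap_apply_of_ne_of_ne hk.symm hij, Equiv.swap_apply_left, eq_comm] at this)
  rw [sum_avgTriple_middle] at h
  push_cast
  rw [h, add_sub_cancel_left]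

theorem smul_avgTriple_right {i j : Fin d} (hij : i ≠ j) :
    ((d - 1 : ℝ) : ℂ) • avgTriple i j j =
      ((1 / (d * (d + 1)) : ℝ) : ℂ) • (1 + omegaOp d 1 1) - avgTriple j j j := by
  have h := sum_eq_add_smul_of_forall_ne (fun i => avgTriple i j j) j (v := avgTriple i j j) (by
    intro k hk
    have := avgTriple_perm (Equiv.swap k i) k j j
    rwa [Equiv.swap_apply_of_ne_of_ne hk.symm hij.symm, Equiv.swap_apply_left, eq_comm] at this)
  rw [sum_avgTriple_left] at h
  push_cast
  rw [h, add_sub_cancel_left]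

/-- With i fixed, the sum over both other indices is I/d; removing the row j = i leaves d - 1 equal
rows, each consisting of two exceptional terms and d - 2 equal ones. -/
theorem smul_avgTriple_distinct {i j k : Fin d} (hij : i ≠ j) (hki : k ≠ i)
    (hkj : k ≠ j) : ((d - 1 : ℝ) : ℂ) • (((d - 2 : ℝ) : ℂ) • avgTriple i j k + avgTriple i j i +
      avgTriple i j j) = ((1 / d : ℝ) : ℂ) • (1 : Matrix (ABC d) (ABC d) ℂ) -
        ((2 / (d * (d + 1)) : ℝ) : ℂ) • symABC d := by
  have h1 := sum_eq_add_add_smul_of_forall_ne (fun k => avgTriple i j k) hij (v := avgTriple i j k)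
    (by
      intro l hli hlj
      have := avgTriple_perm (Equiv.swap l k) i j l
      rwa [Equiv.swap_apply_of_ne_of_ne hli.symm hki.symm, Equiv.swap_apply_left,
        Equiv.swap_apply_of_ne_of_ne hlj.symm hkj.symm, eq_comm] at this)
  have h2 := sum_eq_add_smul_of_forall_ne (fun j => ∑ k, avgTriple i j k) i
    (v := ∑ k, avgTriple i j k) (by
      intro l hl
      rw [← Equiv.sum_comp (Equiv.swap l j) fun k => avgTriple i j k]
      refine Finset.sum_congr rfl fun m _ => ?_
      have := avgTriple_perm (Equiv.swap l j) i l m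
      rwa [Equiv.swap_apply_of_ne_of_ne hl.symm hij, Equiv.swap_apply_left, eq_comm] at this)
  rw [sum_sum_avgTriple, sum_avgTriple_self, h1] at h2
  push_cast
  rw [h2]
  module

/-- The dual operator dominates every averaged product. -/
theorem posSemidef_dualOp_sub_avgTriple (hd : 2 ≤ d) (i j k : Fin d) :
    (dualOp d - avgTriple i j k).PosSemidef := by
  have hd' : (2 : ℝ) ≤ d := by exact_mod_cast hd
  have hdm : (0 : ℝ) < d - 1 := by linarith
  have hinv : ∀ {r : ℝ}, 0 < r → ∀ {X : Matrix (ABC d) (ABC d) ℂ},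
      ((r : ℂ) • X).PosSemidef → X.PosSemidef := by
    intro r hr X hX
    have := PosSemidef.ofReal_smul hX (inv_nonneg.2 hr.le)
    rwa [smul_smul, ← Complex.ofReal_mul, inv_mul_cancel₀ hr.ne', Complex.ofReal_one,
      one_smul] at this
  by_cases hij : i = j
  · subst hij
    -- The averages with i = j sum over the last index to exactly the symmetric part of the dual
    -- operator, so the slack is the sum of the other averages plus the P⁻ part.
    have h : dualOp d - avgTriple i i k = (∑ l ∈ Finset.univ.erase k, avgTriple i i l) +
        ((2 / (3 * d * (d - 1)) : ℝ) : ℂ) • antiABC d := by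
      have h1 := Finset.add_sum_erase Finset.univ (fun l => avgTriple i i l) (Finset.mem_univ k)
      rw [sum_avgTriple_self] at h1
      rw [eq_sub_of_add_eq' h1, dualOp]
      push_cast
      module
    rw [h]
    refine (Matrix.posSemidef_sum _ fun l _ => posSemidef_avgTriple i i l).add
      (PosSemidef.ofReal_smul posSemidef_antiABC ?_)
    positivity
  by_cases hki : k = i
  · subst hki
    refine hinv hdm ?_
    rw [smul_sub, smul_avgTriple_left hij]
    exact posSemidef_smul_dualOp_sub hd 0 k
  by_cases hkj : k = j
  · subst hkj
    refine hinv hdm ?_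
    rw [smul_sub, smul_avgTriple_right hij]
    exact posSemidef_smul_dualOp_sub hd 1 k
  -- Three distinct indices force d ≥ 3, which is needed for dividing by d - 2 and for the sign of
  -- (2d-1)(d-3).
  have hd3 : 3 ≤ d := by
    have := Finset.card_le_univ ({i, j, k} : Finset (Fin d))
    rw [Finset.card_insert_of_notMem (by simp [hij, Ne.symm hki]), Finset.card_pair (Ne.symm hkj),
      Fintype.card_fin] at this
    exact this
  have hd3' : (3 : ℝ) ≤ d := by exact_mod_cast hd3
  have hdm2 : (0 : ℝ) < d - 2 := by linarith
  refine hinv (mul_pos hdm hdm2) ?_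
  have h : (((d - 1) * (d - 2) : ℝ) : ℂ) • (dualOp d - avgTriple i j k) =
      (((2 * d - 1) * (d - 3) / (d * (d + 1)) : ℝ) : ℂ) • symABC d +
      (((2 * d ^ 2 - 5 * d - 1) / (3 * d * (d + 1)) : ℝ) : ℂ) • antiABC d +
      ((1 / (d * (d + 1)) : ℝ) : ℂ) • (omegaOp d 0 0 + omegaOp d 1 1) + avgRest i + avgRest j := by
    have h1 := smul_avgTriple_distinct hij hki hkj
    have h2 := smul_avgTriple_left hij
    have h3 := smul_avgTriple_right hij
    have h4 := avgTriple_self_add_avgRest i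
    have h5 := avgTriple_self_add_avgRest j
    have hd0 : (d : ℂ) ≠ 0 := by exact_mod_cast (by omega : d ≠ 0)
    have hd1 : (d : ℂ) + 1 ≠ 0 := by exact_mod_cast d.succ_ne_zero
    have hdm' : (d : ℂ) - 1 ≠ 0 := by exact_mod_cast hdm.ne'
    have h6 : (((d - 1) * (d - 2) : ℝ) : ℂ) • dualOp d =
        ((1 / d : ℝ) : ℂ) • (1 : Matrix (ABC d) (ABC d) ℂ) +
        (((2 * (d - 1) * (d - 2) / (d * (d + 1)) - 1 / d) : ℝ) : ℂ) • symABC d +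
        ((2 * (d - 2) / (3 * d) - 1 / d : ℝ) : ℂ) • antiABC d := by
      rw [dualOp, ← symABC_add_antiABC]
      match_scalars <;> field_simp <;> ring
    have h7 : ((2 / (d * (d + 1)) : ℝ) : ℂ) • (1 : Matrix (ABC d) (ABC d) ℂ) =
        ((2 / (d * (d + 1)) : ℝ) : ℂ) • (symABC d + antiABC d) := by rw [symABC_add_antiABC]
    rw [smul_sub, h6]
    push_cast at *
    linear_combination (norm := (match_scalars <;> field_simp <;> ring)) (-1 : ℂ) • h1 + h2 + h3 - h4 - h5 + h7
  rw [h]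
  refine ((((PosSemidef.ofReal_smul posSemidef_symABC ?_).add
    (PosSemidef.ofReal_smul posSemidef_antiABC ?_)).add
    (PosSemidef.ofReal_smul ?_ (by positivity))).add (posSemidef_avgRest i)).add
    (posSemidef_avgRest j)
  · exact div_nonneg (mul_nonneg (by linarith) (by linarith)) (by positivity)
  · exact div_nonneg (by nlinarith) (by positivity)
  · rw [omegaOp_self hd, omegaOp_self hd]
    exact (posSemidef_alphaForm _).add (posSemidef_alphaForm _)

/-! ### Trace pairing of positive operators and weak duality -/

open scoped MatrixOrder Matrix.Norms.L2Operator in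
theorem trace_mul_nonneg {n : Type*} [Fintype n] [DecidableEq n] {R X : Matrix n n ℂ}
    (hR : R.PosSemidef) (hX : X.PosSemidef) : 0 ≤ (R * X).trace := by
  obtain ⟨C, hC⟩ := CStarAlgebra.nonneg_iff_eq_star_mul_self.1 (Matrix.nonneg_iff_posSemidef.2 hR)
  rw [Matrix.star_eq_conjTranspose] at hC
  subst hC
  rw [Matrix.mul_assoc, Matrix.trace_mul_comm]
  exact (hX.mul_mul_conjTranspose_same C).trace_nonneg

theorem trace_mul_re_le {n : Type*} [Fintype n] [DecidableEq n] {R X Y : Matrix n n ℂ}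
    (hR : R.PosSemidef) (hXY : (Y - X).PosSemidef) : (R * X).trace.re ≤ (R * Y).trace.re := by
  have h := (Complex.le_def.1 (trace_mul_nonneg hR hXY)).1
  rw [mul_sub, Matrix.trace_sub, Complex.sub_re] at h
  simpa using h

/-- The dual operator acts trivially on C, so only Tr_C S = 1 enters; P⁺ contributes 1 and P⁻
contributes 1/3. -/
theorem trace_tensor_dualOp (hd : 2 ≤ d) {S : Matrix (ABC d) (ABC d) ℂ} (hS : partialTrace S = 1) :
    (S * dualOp d).trace = 4 / 3 := by
  have hd0 : (d : ℂ) ≠ 0 := by exact_mod_cast (by omega : d ≠ 0)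
  have hd1 : (d : ℂ) + 1 ≠ 0 := by exact_mod_cast d.succ_ne_zero
  have hdm : (d : ℂ) - 1 ≠ 0 := sub_ne_zero.2 (by exact_mod_cast (by omega : d ≠ 1))
  rw [dualOp, mul_add, mul_smul_comm, mul_smul_comm, Matrix.trace_add, Matrix.trace_smul,
    Matrix.trace_smul, ← trace_partialTrace_mul, ← trace_partialTrace_mul, hS, Matrix.one_mul,
    Matrix.one_mul, trace_symProj, trace_antiProj]
  push_cast
  simp only [smul_eq_mul]
  field_simp
  norm_num

theorem cloneFidelity_le (hd : 2 ≤ d) {R : Fin d → Fin d → Matrix (Wires d) (Wires d) ℂ}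
    (hR : IsCloningStrategy R) : cloneFidelity R ≤ 4 / (3 * (d : ℝ)) := by
  obtain ⟨S, hS, hS1⟩ := hR.normalized
  have hblock : ∀ k, ∑ i, ∑ j, wireBlock (R i j) k = S := by
    intro k
    simp only [← wireBlock_sum]
    rw [hS, wireBlock_tensorD, Matrix.one_apply_eq, one_smul]
  have hd0 : (0 : ℝ) < d := by exact_mod_cast (by omega : 0 < d)
  calc cloneFidelity R = 1 / (d : ℝ) ^ 2 *
        ∑ i, ∑ j, ∑ k, ((wireBlock (R i j) k * avgTriple i j k).trace).re := cloneFidelity_eq R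
    _ ≤ 1 / (d : ℝ) ^ 2 * ∑ i, ∑ j, ∑ k, ((wireBlock (R i j) k * dualOp d).trace).re := by
      refine mul_le_mul_of_nonneg_left (Finset.sum_le_sum fun i _ => Finset.sum_le_sum fun j _ =>
        Finset.sum_le_sum fun k _ => ?_) (by positivity)
      exact trace_mul_re_le (posSemidef_wireBlock (hR.posSemidef i j) k)
        (posSemidef_dualOp_sub_avgTriple hd i j k)
    _ = 1 / (d : ℝ) ^ 2 * ∑ k : Fin d, (S * dualOp d).trace.re := by
      congr 1
      rw [Finset.sum_congr rfl fun i _ => Finset.sum_comm, Finset.sum_comm]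
      refine Finset.sum_congr rfl fun k _ => ?_
      rw [← hblock k]
      simp only [Finset.sum_mul, Matrix.trace_sum, Complex.re_sum]
    _ = 4 / (3 * (d : ℝ)) := by
      rw [trace_tensor_dualOp hd hS1]
      simp
      field_simp

end bound

/-! ### Symmetric instruments -/

section instrument

variable {d : ℕ}

/-- For each `k`, the number of pairs `i, j` with a given pattern. -/
theorem sum_pattern {V : Type*} [AddCommGroup V] [Module ℂ V] (f : Pattern → V) (k : Fin d) :
    ∑ i, ∑ j, f (pattern i j k) = f .xxx + ((d : ℂ) - 1) • (f .xxy + f .xyx + f .xyy) +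
      (((d : ℂ) - 1) * (d - 2)) • f .xyz := by
  rw [sum_eq_add_smul_of_forall_ne (fun i => ∑ j, f (pattern i j k)) k
    (v := f .xxy + f .xyy + ((d : ℂ) - 2) • f .xyz)]
  · have h := sum_eq_add_smul_of_forall_ne (fun j => f (pattern k j k)) k (v := f .xyx)
      fun j hj => by simp [pattern, hj.symm]
    rw [h]
    simp only [pattern, if_true]
    module
  · intro i hi
    rw [sum_eq_add_add_smul_of_forall_ne (fun j => f (pattern i j k)) hi (v := f .xyz)]
    · simp [pattern, hi, hi.symm]
    · intro j hji hjk
      simp [pattern, hi.symm, hji.symm, hjk.symm]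

/-- At d = 2 the pattern `xyz` does not occur; its count is 0 and the prefactor d/n(ℓ) in
`patternOp` takes the default value 0. -/
theorem patternCard_eq (l : Pattern) : (patternCard d l : ℂ) = d * (match l with
    | .xxx => 1 | .xxy => d - 1 | .xyx => d - 1 | .xyy => d - 1
    | .xyz => (d - 1) * (d - 2)) := by
  have h : (patternCard d l : ℂ) =
      ∑ k : Fin d, ∑ i : Fin d, ∑ j : Fin d, if pattern i j k = l then 1 else 0 := by
    rw [patternCard, Finset.card_filter, Fintype.sum_prod_type]
    simp only [Fintype.sum_prod_type]
    push_cast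
    rw [Finset.sum_congr rfl fun i _ => Finset.sum_comm, Finset.sum_comm]
  rw [h, Finset.sum_congr rfl fun k _ => sum_pattern (fun l' => if l' = l then (1 : ℂ) else 0) k]
  cases l <;> simp [mul_sub]

theorem tensorD_sum {ι : Type*} (s : Finset ι) (M : Matrix (Fin d) (Fin d) ℂ)
    (S : ι → Matrix (ABC d) (ABC d) ℂ) : tensorD M (∑ i ∈ s, S i) = ∑ i ∈ s, tensorD M (S i) := by
  ext x y
  simp [tensorD, Matrix.sum_apply, Finset.mul_sum]

theorem sum_tensorD {ι : Type*} (s : Finset ι) (M : ι → Matrix (Fin d) (Fin d) ℂ)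
    (S : Matrix (ABC d) (ABC d) ℂ) : ∑ i ∈ s, tensorD (M i) S = tensorD (∑ i ∈ s, M i) S := by
  ext x y
  simp [tensorD, Matrix.sum_apply, Finset.sum_mul]

theorem posSemidef_tensorD {M : Matrix (Fin d) (Fin d) ℂ} {S : Matrix (ABC d) (ABC d) ℂ}
    (hM : M.PosSemidef) (hS : S.PosSemidef) : (tensorD M S).PosSemidef :=
  (hM.kronecker hS).submatrix fun x : Wires d => (x.2.1, (x.1, x.2.2))

theorem wireBlock_instrument (s : Params) (i j k : Fin d) :
    wireBlock (instrument d s i j) k = patternOp d s (pattern i j k) := by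
  simp [instrument, wireBlock_sum, wireBlock_tensorD, Matrix.single_apply]

theorem isCloningStrategy_instrument {s : Params} {S : Matrix (ABC d) (ABC d) ℂ}
    (hpos : ∀ l, (patternOp d s l).PosSemidef)
    (hS : ∀ k : Fin d, ∑ i, ∑ j, patternOp d s (pattern i j k) = S) (hS1 : partialTrace S = 1) :
    IsCloningStrategy (instrument d s) where
  posSemidef i j := Matrix.posSemidef_sum _ fun k _ => posSemidef_tensorD
    (by rw [← Matrix.diagonal_single]
        exact Matrix.PosSemidef.diagonal (Pi.single_nonneg.2 zero_le_one)) (hpos _)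
  normalized := by
    refine ⟨S, ?_, hS1⟩
    simp only [instrument]
    rw [Finset.sum_congr rfl fun i _ => Finset.sum_comm, Finset.sum_comm, ← Matrix.sum_single_one,
      ← sum_tensorD]
    refine Finset.sum_congr rfl fun k _ => ?_
    rw [← hS k]
    simp only [tensorD_sum]

/-! ### Explicit form of the optimal instruments -/

/-- The parameters of the convex combination of the two optimal instruments. -/
def mixParams (d : ℕ) (p : ℝ) : Params where
  α := fun l => match l with
    | .xxx => matA d
    | .xyx => (p : ℂ) • matB d
    | .xyy => ((1 - p : ℝ) : ℂ) • (sigmaZ * matB d * sigmaZ)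
    | _ => 0
  β := fun _ => 0
  γ := fun _ => 0

theorem tensorD_add (M : Matrix (Fin d) (Fin d) ℂ) (S T : Matrix (ABC d) (ABC d) ℂ) :
    tensorD M (S + T) = tensorD M S + tensorD M T := by
  ext x y
  simp [tensorD, mul_add]

theorem tensorD_smul (M : Matrix (Fin d) (Fin d) ℂ) (c : ℂ) (S : Matrix (ABC d) (ABC d) ℂ) :
    tensorD M (c • S) = c • tensorD M S := by
  ext x y
  simp [tensorD, mul_left_comm]

theorem optInstrument_eq (p : ℝ) : optInstrument d p = instrument d (mixParams d p) := by
  have hop : ∀ l, patternOp d (mixParams d p) l = (p : ℂ) • patternOp d (optParams₁ d) l +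
      ((1 - p : ℝ) : ℂ) • patternOp d (optParams₂ d) l := by
    intro l
    cases l <;> simp [patternOp, mixParams, optParams₁, optParams₂] <;> module
  have hsmul : ∀ (r : ℝ) (X : Matrix (Wires d) (Wires d) ℂ), r • X = (r : ℂ) • X := by
    intro r X; ext x y; simp
  funext i j
  simp only [optInstrument, Pi.add_apply, Pi.smul_apply, instrument, hop, tensorD_add,
    tensorD_smul, Finset.sum_add_distrib, ← Finset.smul_sum, hsmul]

/-- `a P^+ + b P^-` on `A ⊗ B`. -/
def twist (d : ℕ) (a b : ℝ) : Matrix (Fin d × Fin d) (Fin d × Fin d) ℂ :=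
  (a : ℂ) • symProj d + (b : ℂ) • antiProj d

theorem twist_mul_twist (a b a' b' : ℝ) : twist d a b * twist d a' b' = twist d (a * a') (b * b') := by
  simp only [twist, add_mul, mul_add, smul_mul_smul_comm, symProj_mul_symProj,
    antiProj_mul_antiProj, symProj_mul_antiProj, antiProj_mul_symProj]
  push_cast
  module

/-! ### Partial traces of rank-one α blocks -/

theorem transpose_swapAB : (swapAB d).transpose = swapAB d := by
  ext x y
  simp [swapAB, Prod.ext_iff, and_comm, eq_comm]

theorem transpose_twist (a b : ℝ) : (twist d a b).transpose = twist d a b := by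
  simp [twist, symProj, antiProj, Matrix.transpose_smul, transpose_swapAB]

/-- P⁺ and P⁻ select the Ψ⁺ and Ψ⁻ components of |ω⟩_{AC}|m⟩_B, so aP⁺ + bP⁻ rescales its two
coordinates by a and b. -/
theorem alphaForm_eq_twist (hd : 2 ≤ d) (a b : ℝ) :
    alphaForm d ![a * √((d + 1) / 2), b * √((d - 1) / 2)] =
      (twist d a b ⊗ₖ 1) * omegaOp d 0 0 * (twist d a b ⊗ₖ 1) := by
  rw [omegaOp_self hd, alphaForm_two, alphaForm_two]
  have h : twist d a b ⊗ₖ (1 : Matrix (Fin d) (Fin d) ℂ) =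
      (a : ℂ) • symABC d + (b : ℂ) • antiABC d := by
    rw [twist, Matrix.add_kronecker, Matrix.smul_kronecker, Matrix.smul_kronecker]
  rw [h]
  simp [add_mul, mul_add, symABC_mul_alphaBlock, antiABC_mul_alphaBlock, alphaBlock_mul_symABC,
    alphaBlock_mul_antiABC, -Real.sqrt_div', -Nat.ofNat_nonneg]
  module

theorem partialTrace_kronecker_one_mul {X K : Type*} [Fintype X] [Fintype K] [DecidableEq K]
    (Y : Matrix X X ℂ) (R : Matrix (X × K) (X × K) ℂ) :
    partialTrace ((Y ⊗ₖ 1) * R) = Y * partialTrace R := by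
  ext x y
  simp only [partialTrace, Matrix.of_apply, Matrix.mul_apply, Fintype.sum_prod_type,
    Matrix.kroneckerMap_apply, Matrix.one_apply, Finset.mul_sum]
  rw [Finset.sum_comm]
  simp

theorem partialTrace_mul_kronecker_one {X K : Type*} [Fintype X] [Fintype K] [DecidableEq K]
    (Y : Matrix X X ℂ) (R : Matrix (X × K) (X × K) ℂ) :
    partialTrace (R * (Y ⊗ₖ 1)) = partialTrace R * Y := by
  ext x y
  simp only [partialTrace, Matrix.of_apply, Matrix.mul_apply, Fintype.sum_prod_type,
    Matrix.kroneckerMap_apply, Matrix.one_apply, Finset.sum_mul]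
  rw [Finset.sum_comm]
  simp

theorem partialTrace_omegaOp_mul (E : Matrix (Fin d) (Fin d) ℂ) :
    partialTrace (omegaOp d 0 0 * ((1 : Matrix (Fin d × Fin d) _ ℂ) ⊗ₖ E)) =
      E.transpose ⊗ₖ 1 := by
  ext x y
  simp only [partialTrace, Matrix.of_apply, Matrix.mul_apply, omegaOp_zero_apply,
    Matrix.kroneckerMap_apply, Matrix.one_apply, Fintype.sum_prod_type]
  simp [ite_and, Prod.ext_iff]

/-- The partial trace of a multiple of an optimal block against an operator on `C`. -/
theorem partialTrace_alphaForm_mul (hd : 2 ≤ d) (a b : ℝ) (E : Matrix (Fin d) (Fin d) ℂ) :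
    partialTrace (alphaForm d ![a * √((d + 1) / 2), b * √((d - 1) / 2)] *
        ((1 : Matrix (Fin d × Fin d) _ ℂ) ⊗ₖ E)) =
      twist d a b * (E.transpose ⊗ₖ 1) * twist d a b := by
  have hcomm : (twist d a b ⊗ₖ (1 : Matrix (Fin d) (Fin d) ℂ)) *
      ((1 : Matrix (Fin d × Fin d) _ ℂ) ⊗ₖ E) = (1 ⊗ₖ E) * (twist d a b ⊗ₖ 1) := by
    rw [← Matrix.mul_kronecker_mul, ← Matrix.mul_kronecker_mul, Matrix.mul_one, Matrix.one_mul,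
      Matrix.mul_one, Matrix.one_mul]
  rw [alphaForm_eq_twist hd, Matrix.mul_assoc, hcomm, ← Matrix.mul_assoc, Matrix.mul_assoc _ _ (1 ⊗ₖ E),
    partialTrace_mul_kronecker_one, partialTrace_kronecker_one_mul, partialTrace_omegaOp_mul]

theorem partialTrace_alphaForm (hd : 2 ≤ d) (a b : ℝ) :
    partialTrace (alphaForm d ![a * √((d + 1) / 2), b * √((d - 1) / 2)]) =
      twist d (a * a) (b * b) := by
  have h := partialTrace_alphaForm_mul hd a b 1
  rwa [Matrix.one_kronecker_one, Matrix.mul_one, Matrix.transpose_one, Matrix.one_kronecker_one,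
    Matrix.mul_one, twist_mul_twist] at h

theorem sqrt_dPlus_mul_dMinus (hd : 2 ≤ d) :
    √(dPlus d * dMinus d) = d * (√((d + 1) / 2) * √((d - 1) / 2)) := by
  have hd' : (2 : ℝ) ≤ d := by exact_mod_cast hd
  rw [← Real.sqrt_mul (by linarith), dPlus, dMinus,
    show (d : ℝ) * (d + 1) / 2 * (d * (d - 1) / 2) = d ^ 2 * ((d + 1) / 2 * ((d - 1) / 2)) by ring,
    Real.sqrt_mul (by positivity), Real.sqrt_sq (by positivity)]

theorem matB_eq (hd : 2 ≤ d) : matB d =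
    !![(√((d + 1) / 2) * √((d + 1) / 2) / 9 : ℂ), (√((d + 1) / 2) * √((d - 1) / 2) / 3 : ℂ);
      (√((d + 1) / 2) * √((d - 1) / 2) / 3 : ℂ), (√((d - 1) / 2) * √((d - 1) / 2) : ℂ)] := by
  have hd' : (2 : ℝ) ≤ d := by exact_mod_cast hd
  have h0 : √(((d : ℝ) + 1) / 2) * √((d + 1) / 2) = (d + 1) / 2 :=
    Real.mul_self_sqrt (by linarith)
  have h1 : √(((d : ℝ) - 1) / 2) * √((d - 1) / 2) = (d - 1) / 2 :=
    Real.mul_self_sqrt (by linarith)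
  have e0 : dPlus d / (9 * d) = √((d + 1) / 2) * √((d + 1) / 2) / 9 := by
    rw [h0, dPlus]; field_simp
  have e1 : √(dPlus d * dMinus d) / (3 * d) = √((d + 1) / 2) * √((d - 1) / 2) / 3 := by
    rw [sqrt_dPlus_mul_dMinus hd]; field_simp
  have e2 : dMinus d / d = √((d - 1) / 2) * √((d - 1) / 2) := by
    rw [h1, dMinus]; field_simp
  rw [matB, e0, e1, e2]
  push_cast
  rfl

theorem sum_matB_smul (hd : 2 ≤ d) : ∑ a, ∑ b, matB d a b • alphaBlock d a b =
    ((1 / 9 : ℝ) : ℂ) • alphaForm d ![1 * √((d + 1) / 2), 3 * √((d - 1) / 2)] := by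
  rw [matB_eq hd, alphaForm_two]
  generalize √(((d : ℝ) + 1) / 2) = e
  generalize √(((d : ℝ) - 1) / 2) = f
  simp only [Fin.sum_univ_two, Matrix.of_apply, Matrix.cons_val_zero, Matrix.cons_val_one]
  push_cast
  module

theorem sigmaZ_mul_mul_sigmaZ (a b c e : ℂ) :
    sigmaZ * !![a, b; c, e] * sigmaZ = !![a, -b; -c, e] := by
  ext i j
  fin_cases i <;> fin_cases j <;> simp [sigmaZ, Matrix.mul_apply, Fin.sum_univ_two]

theorem sum_sigmaZ_matB_smul (hd : 2 ≤ d) :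
    ∑ a, ∑ b, (sigmaZ * matB d * sigmaZ) a b • alphaBlock d a b =
    ((1 / 9 : ℝ) : ℂ) • alphaForm d ![1 * √((d + 1) / 2), (-3) * √((d - 1) / 2)] := by
  rw [matB_eq hd, sigmaZ_mul_mul_sigmaZ, alphaForm_two]
  generalize √(((d : ℝ) + 1) / 2) = e
  generalize √(((d : ℝ) - 1) / 2) = f
  simp only [Fin.sum_univ_two, Matrix.of_apply, Matrix.cons_val_zero, Matrix.cons_val_one]
  push_cast
  module

theorem sum_matA_smul (hd : 2 ≤ d) : ∑ a, ∑ b, matA d a b • alphaBlock d a b =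
    ((8 / 9 : ℝ) : ℂ) • alphaForm d ![1 * √((d + 1) / 2), 0 * √((d - 1) / 2)] := by
  have h0 : √(((d : ℝ) + 1) / 2) * √((d + 1) / 2) = (d + 1) / 2 :=
    Real.mul_self_sqrt (by positivity)
  have e0 : 8 * dPlus d / (9 * d) = 8 / 9 * (√((d + 1) / 2) * √((d + 1) / 2)) := by
    rw [h0, dPlus]; field_simp
  rw [matA, alphaForm_two, e0]
  generalize √(((d : ℝ) + 1) / 2) = e
  simp only [Fin.sum_univ_two, Matrix.of_apply, Matrix.cons_val_zero, Matrix.cons_val_one]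
  push_cast
  module

theorem patternOp_mixParams (hd : 2 ≤ d) (p : ℝ) (l : Pattern) : patternOp d (mixParams d p) l =
    match l with
    | .xxx => ((8 / 9 : ℝ) : ℂ) • alphaForm d ![1 * √((d + 1) / 2), 0 * √((d - 1) / 2)]
    | .xyx => ((p / (9 * (d - 1)) : ℝ) : ℂ) •
        alphaForm d ![1 * √((d + 1) / 2), 3 * √((d - 1) / 2)]
    | .xyy => (((1 - p) / (9 * (d - 1)) : ℝ) : ℂ) •
        alphaForm d ![1 * √((d + 1) / 2), (-3) * √((d - 1) / 2)]
    | _ => 0 := by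
  have hd0 : (d : ℂ) ≠ 0 := by exact_mod_cast (by omega : d ≠ 0)
  have hdm : (d : ℂ) - 1 ≠ 0 := sub_ne_zero.2 (by exact_mod_cast (by omega : d ≠ 1))
  cases l <;> simp only [patternOp, patternCard_eq, mixParams, Complex.ofReal_zero, zero_smul,
    add_zero, Matrix.smul_apply, smul_eq_mul, mul_smul, ← Finset.smul_sum, sum_matA_smul hd,
    sum_matB_smul hd, sum_sigmaZ_matB_smul hd, Matrix.zero_apply, Finset.sum_const_zero, smul_zero]
  all_goals
    match_scalars
    field_simp

theorem isCloningStrategy_optInstrument (hd : 2 ≤ d) {p : ℝ} (hp : p ∈ Set.Icc (0 : ℝ) 1) :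
    IsCloningStrategy (optInstrument d p) := by
  have hd' : (2 : ℝ) ≤ d := by exact_mod_cast hd
  have hdm : (0 : ℝ) < d - 1 := by linarith
  have hdm' : (d : ℂ) - 1 ≠ 0 := by exact_mod_cast hdm.ne'
  rw [optInstrument_eq]
  refine isCloningStrategy_instrument (fun l => ?_) (fun k => sum_pattern _ k) ?_
  · rw [patternOp_mixParams hd]
    cases l <;> dsimp only
    · exact PosSemidef.ofReal_smul (posSemidef_alphaForm _) (by norm_num)
    · exact Matrix.PosSemidef.zero
    · exact PosSemidef.ofReal_smul (posSemidef_alphaForm _) (div_nonneg hp.1 (by positivity))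
    · exact PosSemidef.ofReal_smul (posSemidef_alphaForm _)
        (div_nonneg (by linarith [hp.2]) (by positivity))
    · exact Matrix.PosSemidef.zero
  -- On P⁺ the weights are 8/9 + p/9 + (1-p)/9, and on P⁻ they are p + (1-p), the square of ±3
  -- cancelling the 1/9.
  · simp only [patternOp_mixParams hd, zero_add, smul_zero, add_zero, partialTrace_add, partialTrace_smul,
      partialTrace_alphaForm hd]
    rw [← symProj_add_antiProj]
    simp only [twist]
    match_scalars <;> field_simp <;> ring

end instrument

section optimal

variable {d : ℕ}

/-! ### The replicated measurement -/

theorem replicated_eq_sum (R : Fin d → Fin d → Matrix (Wires d) (Wires d) ℂ) (U : SU d)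
    (i j : Fin d) : replicated R U i j = ∑ k, (partialTrace (wireBlock (R i j) k *
      ((1 : Matrix (Fin d × Fin d) _ ℂ) ⊗ₖ vonNeumann U k))).transpose := by
  rw [replicated, link_choi, Matrix.transpose_sum]

theorem transpose_partialTrace_smul_alphaForm_mul (hd : 2 ≤ d) (c a b : ℝ)
    (E : Matrix (Fin d) (Fin d) ℂ) :
    (partialTrace (((c : ℂ) • alphaForm d ![a * √((d + 1) / 2), b * √((d - 1) / 2)]) *
      ((1 : Matrix (Fin d × Fin d) _ ℂ) ⊗ₖ E))).transpose =
      (c : ℂ) • (twist d a b * (E ⊗ₖ 1) * twist d a b) := by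
  rw [Matrix.smul_mul, partialTrace_smul, partialTrace_alphaForm_mul hd, Matrix.transpose_smul,
    Matrix.transpose_mul, Matrix.transpose_mul, transpose_twist, ← Matrix.kroneckerMap_transpose,
    Matrix.transpose_transpose, Matrix.transpose_one, Matrix.mul_assoc]

theorem replicated_optInstrument_self (hd : 2 ≤ d) (U : SU d) (i : Fin d) :
    replicated (optInstrument d (1 / 2)) U i i =
      (8 / 9 : ℂ) • (symProj d * (vonNeumann U i ⊗ₖ 1) * symProj d) := by
  have h1 : twist d 1 0 = symProj d := by simp [twist]
  rw [optInstrument_eq, replicated_eq_sum, Finset.sum_eq_single i]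
  · rw [wireBlock_instrument, patternOp_mixParams hd, show pattern i i i = .xxx by simp [pattern]]
    dsimp only
    rw [transpose_partialTrace_smul_alphaForm_mul hd, h1]
    norm_num
  · intro k _ hk
    rw [wireBlock_instrument, patternOp_mixParams hd, show pattern i i k = .xxy by simp [pattern, hk]]
    ext x y
    simp [partialTrace]
  · simp

/-- The relation 1/√2 = 3/√18 matches Q^± with the coefficients (1, ±3) of B and σ_z B σ_z; the
square 1/18 combines their 1/9 with the weight p = 1/2. -/
theorem matQ_eq (ε : Fin 2) : matQ d ε = ((1 / √18 : ℝ) : ℂ) • twist d 1 (3 * sgn ε) := by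
  have h : sgn ε / √2 = 1 / √18 * (3 * sgn ε) := by
    rw [show (18 : ℝ) = 3 ^ 2 * 2 by norm_num, Real.sqrt_mul (by norm_num),
      Real.sqrt_sq (by norm_num)]
    field_simp
  rw [matQ, h, twist]
  push_cast
  module

theorem replicated_optInstrument_of_ne (hd : 2 ≤ d) (U : SU d) {i j : Fin d} (hij : i ≠ j) :
    replicated (optInstrument d (1 / 2)) U i j =
      (1 / ((d : ℂ) - 1)) • (matQ d 0 * (vonNeumann U i ⊗ₖ 1) * matQ d 0 +
        matQ d 1 * (vonNeumann U j ⊗ₖ 1) * matQ d 1) := by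
  have hdm : (d : ℂ) - 1 ≠ 0 := sub_ne_zero.2 (by exact_mod_cast (by omega : d ≠ 1))
  have h18 : ((1 / √18 : ℝ) : ℂ) * ((1 / √18 : ℝ) : ℂ) = 1 / 18 := by
    rw [← Complex.ofReal_mul, div_mul_div_comm, Real.mul_self_sqrt (by norm_num)]
    norm_num
  have hz : ∀ k, k ≠ i → k ≠ j → (partialTrace (wireBlock (instrument d (mixParams d (1 / 2)) i j) k
      * ((1 : Matrix (Fin d × Fin d) _ ℂ) ⊗ₖ vonNeumann U k))).transpose = 0 := by
    intro k hki hkj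
    rw [wireBlock_instrument, patternOp_mixParams hd,
      show pattern i j k = .xyz by simp [pattern, hki, hkj, hij]]
    ext x y
    simp [partialTrace]
  rw [optInstrument_eq, replicated_eq_sum, sum_eq_add_add_smul_of_forall_ne _ hij hz, smul_zero,
    add_zero, wireBlock_instrument, wireBlock_instrument,
    show pattern i j i = .xyx by simp [pattern, hij],
    show pattern i j j = .xyy by simp [pattern, hij, hij.symm], patternOp_mixParams hd,
    patternOp_mixParams hd]
  dsimp only
  rw [transpose_partialTrace_smul_alphaForm_mul hd, transpose_partialTrace_smul_alphaForm_mul hd,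
    matQ_eq, matQ_eq]
  simp only [smul_mul_assoc, mul_smul_comm, smul_smul, h18, sgn_zero, sgn_one, mul_one, mul_neg]
  match_scalars <;> field_simp <;> norm_num

/-! ### Traces against the averaged products -/

theorem alphaBlock_eq_omegaOp (a b : Fin 2) : alphaBlock d a b =
    ((psiNorm d a * psiNorm d b : ℝ) : ℂ) • (omegaOp d 0 0 + (sgn b : ℂ) • omegaOp d 0 1 +
      (sgn a : ℂ) • omegaOp d 1 0 + ((sgn a * sgn b : ℝ) : ℂ) • omegaOp d 1 1) := by
  simp only [alphaBlock, omegaOp, Finset.smul_sum, ← Finset.sum_add_distrib]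
  refine Finset.sum_congr rfl fun m _ => ?_
  ext x y
  simp [Psi_eq, Matrix.vecMulVec_apply]
  ring

theorem trace_mul_avgTriple_of_const (X : Matrix (ABC d) (ABC d) ℂ) (i j k : Fin d) {c : ℂ}
    (h : ∀ U : SU d, (X * tripleProj U i j k).trace = c) : (X * avgTriple i j k).trace = c := by
  rw [avgTriple, ← integral_trace_const_mul X (continuous_tripleProj i j k)]
  simp [h]

/-- The trace is already independent of U before averaging, because it involves only traces of the
E's and of their products. -/
theorem trace_alphaBlock_mul_avgTriple (a b : Fin 2) (i j k : Fin d) :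
    (alphaBlock d a b * avgTriple i j k).trace = ((psiNorm d a * psiNorm d b *
      ((if k = i then 1 else 0) + (sgn a + sgn b) * (if k = i ∧ k = j then 1 else 0) +
        sgn a * sgn b * (if k = j then 1 else 0)) : ℝ) : ℂ) := by
  refine trace_mul_avgTriple_of_const _ i j k fun U => ?_
  rw [Matrix.trace_mul_comm, alphaBlock_eq_omegaOp]
  simp only [mul_smul_comm, mul_add, Matrix.trace_smul, Matrix.trace_add,
    trace_tripleProj_mul_omegaOp]
  simp only [if_true, zero_ne_one, one_ne_zero, if_false, smul_eq_mul]
  split_ifs <;> (push_cast; ring)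

theorem trace_swap_mul (X Y : Matrix (Fin d) (Fin d) ℂ) :
    (swapAB d * (X ⊗ₖ Y)).trace = (X * Y).trace := by
  simp [Matrix.trace, Matrix.mul_apply, swapAB, Fintype.sum_prod_type, Prod.ext_iff, ite_and]
  exact Finset.sum_comm

theorem trace_symABC_mul_avgTriple (i j k : Fin d) :
    (symABC d * avgTriple i j k).trace = (((1 + if i = j then 1 else 0) / 2 : ℝ) : ℂ) := by
  refine trace_mul_avgTriple_of_const _ i j k fun U => ?_
  rw [tripleProj, ← Matrix.mul_kronecker_mul, Matrix.one_mul, Matrix.trace_kronecker,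
    trace_vonNeumann, symProj, smul_mul_assoc, add_mul, one_mul, Matrix.trace_smul,
    Matrix.trace_add, trace_swap_mul, ← Matrix.transpose_mul, Matrix.trace_transpose,
    Matrix.trace_kronecker, Matrix.trace_transpose, Matrix.trace_transpose, trace_vonNeumann,
    trace_vonNeumann, vonNeumann_mul_vonNeumann]
  by_cases h : i = j
  · simp [h, trace_vonNeumann]; norm_num
  · simp [h, Ne.symm h]

theorem trace_antiABC_mul_avgTriple (i j k : Fin d) :
    (antiABC d * avgTriple i j k).trace = (((1 - if i = j then 1 else 0) / 2 : ℝ) : ℂ) := by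
  have h1 : (avgTriple i j k).trace = 1 := by
    have := trace_mul_avgTriple_of_const (1 : Matrix (ABC d) (ABC d) ℂ) i j k (c := 1) fun U => by
      simp [tripleProj, Matrix.trace_kronecker, trace_vonNeumann]
    rwa [one_mul] at this
  rw [eq_sub_of_add_eq' (symABC_add_antiABC (d := d)), sub_mul, one_mul, Matrix.trace_sub, h1,
    trace_symABC_mul_avgTriple]
  push_cast
  ring

/-! ### The optimal fidelity -/

theorem trace_alphaForm_mul_avgTriple (hd : 2 ≤ d) (a b : ℝ) (i j k : Fin d) :
    (alphaForm d ![a * √((d + 1) / 2), b * √((d - 1) / 2)] * avgTriple i j k).trace =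
      (((a + b) ^ 2 / 4 * (if k = i then 1 else 0) + (a - b) ^ 2 / 4 * (if k = j then 1 else 0) +
        (a ^ 2 - b ^ 2) / 2 * (if k = i ∧ k = j then 1 else 0) : ℝ) : ℂ) := by
  have h0 : √(((d : ℝ) + 1) / 2) * psiNorm d 0 = 1 / 2 := sqrt_half_mul_psiNorm hd 0
  have h1 : √(((d : ℝ) - 1) / 2) * psiNorm d 1 = 1 / 2 := by
    rw [sub_eq_add_neg]; exact sqrt_half_mul_psiNorm hd 1
  rw [alphaForm_two]
  simp only [add_mul, Matrix.smul_mul, Matrix.trace_add, Matrix.trace_smul,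
    trace_alphaBlock_mul_avgTriple, smul_eq_mul, ← Complex.ofReal_mul, ← Complex.ofReal_add]
  congr 1
  generalize √(((d : ℝ) + 1) / 2) = e at *
  generalize √(((d : ℝ) - 1) / 2) = f at *
  generalize psiNorm d 0 = c at *
  generalize psiNorm d 1 = g at *
  simp only [sgn_zero, sgn_one]
  generalize (if k = i then (1 : ℝ) else 0) = x
  generalize (if k = j then (1 : ℝ) else 0) = y
  generalize (if k = i ∧ k = j then (1 : ℝ) else 0) = z
  have h00 : (e * c) * (e * c) = 1 / 4 := by rw [h0]; norm_num
  have h01 : (e * c) * (f * g) = 1 / 4 := by rw [h0, h1]; norm_num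
  have h11 : (f * g) * (f * g) = 1 / 4 := by rw [h1]; norm_num
  linear_combination (a ^ 2 * (x + 2 * z + y)) * h00 + (2 * a * b * (x - y)) * h01 +
    (b ^ 2 * (x - 2 * z + y)) * h11

theorem cloneFidelity_instrument (s : Params) : cloneFidelity (instrument d s) = 1 / (d : ℝ) ^ 2 *
    ∑ i, ∑ j, ∑ k, ((patternOp d s (pattern i j k) * avgTriple i j k).trace).re := by
  rw [cloneFidelity_eq]
  simp only [wireBlock_instrument]

theorem cloneFidelity_optInstrument (hd : 2 ≤ d) (p : ℝ) :
    cloneFidelity (optInstrument d p) = 4 / (3 * (d : ℝ)) := by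
  have hd' : (2 : ℝ) ≤ d := by exact_mod_cast hd
  have hdm : (0 : ℝ) < d - 1 := by linarith
  -- The α form with coefficients (a, b) gives a² on `xxx`, (a+b)²/4 on `xyx` and (a-b)²/4 on `xyy`;
  -- with (1, 0) and (1, ±3) the nonzero values are 1, 4 and 4. Summed over i, j for one k, the
  -- total is 8/9 + 4/9.
  let val : Pattern → ℂ := fun l => match l with
    | .xxx => 8 / 9 | .xyx => 4 * p / (9 * (d - 1)) | .xyy => 4 * (1 - p) / (9 * (d - 1)) | _ => 0
  have hval : ∀ i j k : Fin d,
      (patternOp d (mixParams d p) (pattern i j k) * avgTriple i j k).trace =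
        val (pattern i j k) := by
    intro i j k
    rw [patternOp_mixParams hd]
    by_cases hij : i = j
    · subst hij
      by_cases hk : k = i
      · simp only [pattern, hk, if_true, val, Matrix.smul_mul, Matrix.trace_smul,
          trace_alphaForm_mul_avgTriple hd]
        norm_num
      · simp [pattern, hk, val]
    · by_cases hki : k = i
      · have hkj : k ≠ j := fun h => hij (hki.symm.trans h)
        rw [show pattern i j k = .xyx by simp [pattern, hij, hki]]
        simp only [Matrix.smul_mul, Matrix.trace_smul, trace_alphaForm_mul_avgTriple hd, hki, hij,
          if_true, if_false, and_false, val]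
        push_cast
        rw [smul_eq_mul]
        ring
      · by_cases hkj : k = j
        · rw [show pattern i j k = .xyy by simp [pattern, hij, hkj, Ne.symm hij]]
          simp only [Matrix.smul_mul, Matrix.trace_smul, trace_alphaForm_mul_avgTriple hd, hkj,
            Ne.symm hij, if_true, if_false, false_and, val]
          push_cast
          rw [smul_eq_mul]
          ring
        · simp [pattern, hij, hki, hkj, val]
  rw [optInstrument_eq, cloneFidelity_instrument]
  have hsum : ∑ i, ∑ j, ∑ k, ((patternOp d (mixParams d p) (pattern i j k) *
      avgTriple i j k).trace).re = (∑ k : Fin d, ∑ i, ∑ j, val (pattern i j k)).re := by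
    rw [Finset.sum_congr rfl fun i _ => Finset.sum_comm, Finset.sum_comm]
    simp only [hval, Complex.re_sum]
  rw [hsum]
  have hsum2 : val .xxx + ((d : ℂ) - 1) • (val .xxy + val .xyx + val .xyy) +
      (((d : ℂ) - 1) * (d - 2)) • val .xyz = ((4 / 3 : ℝ) : ℂ) := by
    have hdm' : (d : ℂ) - 1 ≠ 0 := by exact_mod_cast hdm.ne'
    simp only [val, smul_eq_mul]
    push_cast
    field_simp
    ring
  simp only [sum_pattern val, hsum2, Finset.sum_const, Finset.card_univ, Fintype.card_fin,
    nsmul_eq_mul]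
  rw [← Complex.ofReal_natCast, ← Complex.ofReal_mul, Complex.ofReal_re]
  field_simp

end optimal

/-! ### Uniqueness among the symmetric instruments -/

section uniqueness

variable {d : ℕ}

/-- Complementary slackness for an optimal cloning strategy. -/
theorem trace_slack_eq_zero (hd : 2 ≤ d) {R : Fin d → Fin d → Matrix (Wires d) (Wires d) ℂ}
    (hR : IsCloningStrategy R) (hF : cloneFidelity R = 4 / (3 * (d : ℝ))) (i j k : Fin d) :
    (wireBlock (R i j) k * (dualOp d - avgTriple i j k)).trace = 0 := by
  obtain ⟨S, hS, hS1⟩ := hR.normalized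
  have hblock : ∀ k, ∑ i, ∑ j, wireBlock (R i j) k = S := by
    intro k
    simp only [← wireBlock_sum]
    rw [hS, wireBlock_tensorD, Matrix.one_apply_eq, one_smul]
  have hd0 : (0 : ℝ) < d := by exact_mod_cast (by omega : 0 < d)
  have hnn : ∀ i j k, 0 ≤ (wireBlock (R i j) k * (dualOp d - avgTriple i j k)).trace :=
    fun i j k => trace_mul_nonneg (posSemidef_wireBlock (hR.posSemidef i j) k)
      (posSemidef_dualOp_sub_avgTriple hd i j k)
  have hre : ∀ i j k, 0 ≤ (wireBlock (R i j) k * (dualOp d - avgTriple i j k)).trace.re :=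
    fun i j k => (Complex.le_def.1 (hnn i j k)).1
  have hY : ∑ i, ∑ j, ∑ k, (wireBlock (R i j) k * dualOp d).trace.re = d * (4 / 3) := by
    rw [Finset.sum_congr rfl fun i _ => Finset.sum_comm, Finset.sum_comm]
    have : ∀ k : Fin d, ∑ i, ∑ j, (wireBlock (R i j) k * dualOp d).trace.re = 4 / 3 := by
      intro k
      have h := congrArg Complex.re (trace_tensor_dualOp hd hS1)
      rw [← hblock k] at h
      simp only [Finset.sum_mul, Matrix.trace_sum, Complex.re_sum] at h
      rw [h]
      norm_num
    simp [this]
  have hX : ∑ i, ∑ j, ∑ k, (wireBlock (R i j) k * avgTriple i j k).trace.re = d * (4 / 3) := by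
    rw [cloneFidelity_eq] at hF
    field_simp at hF
    linarith
  have hsum : ∑ i, ∑ j, ∑ k,
      (wireBlock (R i j) k * (dualOp d - avgTriple i j k)).trace.re = 0 := by
    simp only [mul_sub, Matrix.trace_sub, Complex.sub_re, Finset.sum_sub_distrib, hX, hY, sub_self]
  have h1 := (Finset.sum_eq_zero_iff_of_nonneg fun i _ => Finset.sum_nonneg fun j _ =>
    Finset.sum_nonneg fun k _ => hre i j k).1 hsum i (Finset.mem_univ i)
  have h2 := (Finset.sum_eq_zero_iff_of_nonneg fun j _ =>
    Finset.sum_nonneg fun k _ => hre i j k).1 h1 j (Finset.mem_univ j)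
  have h3 := (Finset.sum_eq_zero_iff_of_nonneg fun k _ => hre i j k).1 h2 k (Finset.mem_univ k)
  -- Nonnegativity in the complex order includes the vanishing of the imaginary part.
  exact Complex.ext h3 (Complex.le_def.1 (hnn i j k)).2.symm

/-- The part of an invariant operator on the two copies of the `α` representation. -/
def alphaPart (d : ℕ) (M : Matrix (Fin 2) (Fin 2) ℂ) : Matrix (ABC d) (ABC d) ℂ :=
  ∑ a, ∑ b, M a b • alphaBlock d a b

theorem patternOp_eq (s : Params) (l : Pattern) : patternOp d s l = ((d : ℂ) / patternCard d l) •
    (alphaPart d (s.α l) + (s.β l : ℂ) • betaProj d + (s.γ l : ℂ) • gammaProj d) := rfl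

theorem patternCard_pattern_pos (i j k : Fin d) : 0 < patternCard d (pattern i j k) :=
  Finset.card_pos.2 ⟨(i, j, k), by simp⟩

/-! ### Positivity of the separate components of an invariant operator -/

theorem alphaPart_mulVec_Psi (hd : 2 ≤ d) (M : Matrix (Fin 2) (Fin 2) ℂ) (b : Fin 2) (m : Fin d) :
    (alphaPart d M).mulVec (Psi d b m) = ∑ a, M a b • Psi d a m := by
  simp only [alphaPart, Matrix.sum_mulVec, Matrix.smul_mulVec, alphaBlock_mulVec_Psi hd]
  fin_cases b <;> simp [Fin.sum_univ_two]

theorem mul_alphaPart_eq_zero {X : Matrix (ABC d) (ABC d) ℂ} (M : Matrix (Fin 2) (Fin 2) ℂ)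
    (h : ∀ a b, X * alphaBlock d a b = 0) : X * alphaPart d M = 0 := by
  simp [alphaPart, mul_add, h]

theorem betaProj_mulVec_Psi (ε : Fin 2) (hd : 2 ≤ d) (m : Fin d) :
    (betaProj d).mulVec (Psi d ε m) = 0 := by
  rw [betaProj_eq, Matrix.sub_mulVec, symABC_mulVec_Psi, alphaBlock_mulVec_Psi hd]
  fin_cases ε <;> simp

theorem gammaProj_mulVec_Psi (ε : Fin 2) (hd : 2 ≤ d) (m : Fin d) :
    (gammaProj d).mulVec (Psi d ε m) = 0 := by
  rw [gammaProj_eq, Matrix.sub_mulVec, antiABC_mulVec_Psi, alphaBlock_mulVec_Psi hd]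
  fin_cases ε <;> simp

/-- For a single m the vectors Ψ⁺_m, Ψ⁻_m are orthonormal and killed by P^β and P^γ, so compressing
to their span returns the multiplicity matrix. -/
theorem posSemidef_of_invariant (hd : 2 ≤ d) {M : Matrix (Fin 2) (Fin 2) ℂ} {b c : ℂ}
    (h : (alphaPart d M + b • betaProj d + c • gammaProj d).PosSemidef) : M.PosSemidef := by
  let o : Fin d := ⟨0, by omega⟩
  have h1 := h.conjTranspose_mul_mul_same (Matrix.of fun (x : ABC d) (a : Fin 2) => Psi d a o x)
  convert h1 using 1
  ext a e
  have h2 : (alphaPart d M + b • betaProj d + c • gammaProj d).mulVec (Psi d e o) =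
      ∑ a, M a e • Psi d a o := by
    rw [Matrix.add_mulVec, Matrix.add_mulVec, Matrix.smul_mulVec, Matrix.smul_mulVec,
      alphaPart_mulVec_Psi hd, betaProj_mulVec_Psi e hd, gammaProj_mulVec_Psi e hd]
    simp
  have h3 : (star (Psi d a o)) ⬝ᵥ (alphaPart d M + b • betaProj d + c • gammaProj d).mulVec
      (Psi d e o) = M a e := by
    rw [h2, star_Psi]
    simp only [dotProduct_sum, dotProduct_smul, Psi_dotProduct hd]
    simp
  rw [← h3, Matrix.mul_assoc]
  rfl

theorem beta_smul_posSemidef (hd : 2 ≤ d) {M : Matrix (Fin 2) (Fin 2) ℂ} {b c : ℂ}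
    (h : (alphaPart d M + b • betaProj d + c • gammaProj d).PosSemidef) :
    (b • betaProj d).PosSemidef := by
  have h1 := h.mul_mul_conjTranspose_same (betaProj d)
  rw [conjTranspose_betaProj, mul_add, mul_add, mul_alphaPart_eq_zero M (betaProj_mul_alphaBlock hd),
    mul_smul_comm, mul_smul_comm, betaProj_mul_betaProj hd, betaProj_mul_gammaProj hd, smul_zero,
    zero_add, add_zero, smul_mul_assoc, betaProj_mul_betaProj hd] at h1
  exact h1

theorem gamma_smul_posSemidef (hd : 2 ≤ d) {M : Matrix (Fin 2) (Fin 2) ℂ} {b c : ℂ}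
    (h : (alphaPart d M + b • betaProj d + c • gammaProj d).PosSemidef) :
    (c • gammaProj d).PosSemidef := by
  have h1 := h.mul_mul_conjTranspose_same (gammaProj d)
  rw [conjTranspose_gammaProj, mul_add, mul_add,
    mul_alphaPart_eq_zero M (gammaProj_mul_alphaBlock hd), mul_smul_comm, mul_smul_comm,
    gammaProj_mul_gammaProj hd, gammaProj_mul_betaProj hd, smul_zero, zero_add, zero_add,
    smul_mul_assoc, gammaProj_mul_gammaProj hd] at h1
  exact h1

theorem posSemidef_alphaPart {M : Matrix (Fin 2) (Fin 2) ℂ} (hM : M.PosSemidef) :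
    (alphaPart d M).PosSemidef := by
  have h : alphaPart d M = ∑ m, (Matrix.of fun (x : ABC d) (a : Fin 2) => Psi d a m x) * M *
      (Matrix.of fun (x : ABC d) (a : Fin 2) => Psi d a m x).conjTranspose := by
    simp only [alphaPart, alphaBlock, Fin.sum_univ_two, Finset.smul_sum, ← Finset.sum_add_distrib]
    refine Finset.sum_congr rfl fun m _ => ?_
    ext x y
    simp [Matrix.vecMulVec_apply, Matrix.mul_apply, Fin.sum_univ_two]
    ring
  rw [h]
  exact Matrix.posSemidef_sum _ fun m _ => hM.mul_mul_conjTranspose_same _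

/-- The value of `Tr[P^α ⊗ |a⟩⟨b| (Y - Ω)]`, for the dual operator `Y` and an average `Ω`. -/
theorem trace_alphaBlock_mul_slack (hd : 2 ≤ d) (a b : Fin 2) (i j k : Fin d) :
    (alphaBlock d a b * (dualOp d - avgTriple i j k)).trace =
      (((if a = b then (if a = 0 then 2 / ((d : ℝ) + 1) else 2 / (3 * (d - 1))) else 0) -
        psiNorm d a * psiNorm d b *
      ((if k = i then 1 else 0) + (sgn a + sgn b) * (if k = i ∧ k = j then 1 else 0) +
        sgn a * sgn b * (if k = j then 1 else 0)) : ℝ) : ℂ) := by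
  have hd0 : (d : ℂ) ≠ 0 := by exact_mod_cast (by omega : d ≠ 0)
  have hd1 : (d : ℂ) + 1 ≠ 0 := by exact_mod_cast d.succ_ne_zero
  have hdm : (d : ℂ) - 1 ≠ 0 := sub_ne_zero.2 (by exact_mod_cast (by omega : d ≠ 1))
  rw [mul_sub, Matrix.trace_sub, trace_alphaBlock_mul_avgTriple, dualOp, mul_add, mul_smul_comm,
    mul_smul_comm, alphaBlock_mul_symABC, alphaBlock_mul_antiABC, Complex.ofReal_sub]
  congr 1
  fin_cases a <;> fin_cases b <;> simp [trace_alphaBlock hd] <;> field_simp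

theorem psiNorm_mul_self (hd : 2 ≤ d) (ε : Fin 2) :
    psiNorm d ε * psiNorm d ε = 1 / (2 * (d + sgn ε)) := by
  rw [eq_div_iff (two_mul_add_sgn_pos hd ε).ne', ← sq]
  exact psiNorm_sq hd ε

theorem trace_betaProj_mul_slack (hd : 2 ≤ d) (i j k : Fin d) :
    (betaProj d * (dualOp d - avgTriple i j k)).trace = (((d + 2) * (d - 1) / (d + 1) -
      ((1 + if i = j then 1 else 0) / 2 - 1 / (2 * (d + 1)) * ((if k = i then 1 else 0) +
        2 * (if k = i ∧ k = j then 1 else 0) + (if k = j then 1 else 0))) : ℝ) : ℂ) := by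
  have hd0 : (d : ℂ) ≠ 0 := by exact_mod_cast (by omega : d ≠ 0)
  have hd1 : (d : ℂ) + 1 ≠ 0 := by exact_mod_cast d.succ_ne_zero
  have hY : betaProj d * dualOp d = ((2 / (d * (d + 1)) : ℝ) : ℂ) • betaProj d := by
    simp [dualOp, betaProj_eq, sub_mul, mul_add, symABC_mul_symABC, symABC_mul_antiABC,
      alphaBlock_mul_symABC, alphaBlock_mul_antiABC, smul_sub]
  rw [mul_sub, hY, Matrix.trace_sub, Matrix.trace_smul, trace_betaProj hd, betaProj_eq, sub_mul,
    Matrix.trace_sub, trace_symABC_mul_avgTriple, trace_alphaBlock_mul_avgTriple,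
    psiNorm_mul_self hd, sgn_zero]
  push_cast
  rw [smul_eq_mul]
  field_simp
  ring

theorem trace_gammaProj_mul_slack (hd : 2 ≤ d) (i j k : Fin d) :
    (gammaProj d * (dualOp d - avgTriple i j k)).trace = (((d - 2) * (d + 1) / (3 * (d - 1)) -
      ((1 - if i = j then 1 else 0) / 2 - 1 / (2 * (d - 1)) * ((if k = i then 1 else 0) -
        2 * (if k = i ∧ k = j then 1 else 0) + (if k = j then 1 else 0))) : ℝ) : ℂ) := by
  have hd0 : (d : ℂ) ≠ 0 := by exact_mod_cast (by omega : d ≠ 0)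
  have hdm : (d : ℂ) - 1 ≠ 0 := sub_ne_zero.2 (by exact_mod_cast (by omega : d ≠ 1))
  have hY : gammaProj d * dualOp d = ((2 / (3 * d * (d - 1)) : ℝ) : ℂ) • gammaProj d := by
    simp [dualOp, gammaProj_eq, sub_mul, mul_add, antiABC_mul_antiABC, antiABC_mul_symABC,
      alphaBlock_mul_symABC, alphaBlock_mul_antiABC, smul_sub]
  rw [mul_sub, hY, Matrix.trace_sub, Matrix.trace_smul, trace_gammaProj hd, gammaProj_eq, sub_mul,
    Matrix.trace_sub, trace_antiABC_mul_avgTriple, trace_alphaBlock_mul_avgTriple,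
    psiNorm_mul_self hd, sgn_one, ← sub_eq_add_neg]
  push_cast
  rw [smul_eq_mul]
  field_simp
  ring

/-- The dual operator has trace greater than 1 on P^β, while the average is a state-like operator
with trace at most 1 there. Complementary slackness thus excludes a β component. -/
theorem trace_betaProj_mul_slack_ne_zero (hd : 2 ≤ d) (i j k : Fin d) :
    (betaProj d * (dualOp d - avgTriple i j k)).trace ≠ 0 := by
  have hd' : (2 : ℝ) ≤ d := by exact_mod_cast hd
  rw [trace_betaProj_mul_slack hd]
  have h1 : (1 : ℝ) < (d + 2) * (d - 1) / (d + 1) := by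
    rw [lt_div_iff₀ (by positivity)]
    nlinarith
  have h2 : (1 + if i = j then (1 : ℝ) else 0) / 2 ≤ 1 := by split_ifs <;> norm_num
  have h3 : 0 ≤ 1 / (2 * ((d : ℝ) + 1)) * ((if k = i then 1 else 0) +
      2 * (if k = i ∧ k = j then 1 else 0) + (if k = j then 1 else 0)) := by positivity
  refine Complex.ofReal_ne_zero.2 (ne_of_gt ?_)
  linarith

/-- On P^γ the dual trace exceeds 1/2, whereas the average has weight at most 1/2 on P⁻. At d = 2
there is nothing to exclude, since P^γ vanishes. -/
theorem trace_gammaProj_mul_slack_ne_zero (hd : 3 ≤ d) (i j k : Fin d) :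
    (gammaProj d * (dualOp d - avgTriple i j k)).trace ≠ 0 := by
  have hd' : (3 : ℝ) ≤ d := by exact_mod_cast hd
  rw [trace_gammaProj_mul_slack (by omega)]
  have h1 : (1 / 2 : ℝ) < (d - 2) * (d + 1) / (3 * (d - 1)) := by
    rw [lt_div_iff₀ (by linarith)]
    nlinarith
  have h2 : (1 - if i = j then (1 : ℝ) else 0) / 2 ≤ 1 / 2 := by split_ifs <;> norm_num
  have h3 : 0 ≤ 1 / (2 * ((d : ℝ) - 1)) * ((if k = i then 1 else 0) -
      2 * (if k = i ∧ k = j then 1 else 0) + (if k = j then 1 else 0)) := by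
    refine mul_nonneg (div_nonneg zero_le_one (by linarith)) ?_
    split_ifs <;> simp_all
    norm_num
  refine Complex.ofReal_ne_zero.2 (ne_of_gt ?_)
  linarith

/-- Complementary slackness for a symmetric instrument, in each representation. -/
theorem slack_instrument (hd : 2 ≤ d) {s : Params} (hs : IsCloningStrategy (instrument d s))
    (hF : cloneFidelity (instrument d s) = 4 / (3 * (d : ℝ))) (i j k : Fin d) :
    (s.α (pattern i j k)).PosSemidef ∧ s.β (pattern i j k) = 0 ∧
      (s.γ (pattern i j k) : ℂ) • gammaProj d = 0 ∧
      ∑ a, ∑ b, s.α (pattern i j k) a b *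
        (alphaBlock d a b * (dualOp d - avgTriple i j k)).trace = 0 := by
  have hpos := posSemidef_wireBlock (hs.posSemidef i j) k
  have htr := trace_slack_eq_zero hd hs hF i j k
  have hD := posSemidef_dualOp_sub_avgTriple hd i j k
  have hβ0 := trace_betaProj_mul_slack_ne_zero hd i j k
  have hγ0 : d = 2 ∨ (gammaProj d * (dualOp d - avgTriple i j k)).trace ≠ 0 := by
    rcases Nat.lt_or_ge 2 d with h | h
    · exact Or.inr (trace_gammaProj_mul_slack_ne_zero h i j k)
    · exact Or.inl (le_antisymm h hd)
  generalize dualOp d - avgTriple i j k = D at *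
  rw [wireBlock_instrument, patternOp_eq] at hpos htr
  have hn := patternCard_pattern_pos i j k
  generalize pattern i j k = l at *
  have hr : (0 : ℝ) < patternCard d l / d :=
    div_pos (by exact_mod_cast hn) (by exact_mod_cast (by omega : 0 < d))
  have hr1 : ((patternCard d l / d : ℝ) : ℂ) * ((d : ℂ) / patternCard d l) = 1 := by
    have h1 : (patternCard d l : ℂ) ≠ 0 := by exact_mod_cast hn.ne'
    have h2 : (d : ℂ) ≠ 0 := by exact_mod_cast (by omega : d ≠ 0)
    push_cast
    field_simp
  replace hpos := PosSemidef.ofReal_smul hpos hr.le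
  rw [smul_smul, hr1, one_smul] at hpos
  have hM := posSemidef_of_invariant hd hpos
  have hβ := beta_smul_posSemidef hd hpos
  have hγ := gamma_smul_posSemidef hd hpos
  have tα := trace_mul_nonneg (posSemidef_alphaPart (d := d) hM) hD
  have tβ := trace_mul_nonneg hβ hD
  have tγ := trace_mul_nonneg hγ hD
  have hsum : (alphaPart d (s.α l) * D).trace + ((s.β l : ℂ) • betaProj d * D).trace +
      ((s.γ l : ℂ) • gammaProj d * D).trace = 0 := by
    have : (d : ℂ) / patternCard d l ≠ 0 := right_ne_zero_of_mul_eq_one hr1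
    rw [smul_mul_assoc, Matrix.trace_smul, smul_eq_mul] at htr
    have := (mul_eq_zero.1 htr).resolve_left this
    rwa [add_mul, add_mul, Matrix.trace_add, Matrix.trace_add] at this
  -- The three traces are nonnegative with sum zero, so slackness holds in each representation
  -- separately.
  obtain ⟨h1, h3⟩ := (add_eq_zero_iff_of_nonneg (add_nonneg tα tβ) tγ).1 hsum
  obtain ⟨h1, h2⟩ := (add_eq_zero_iff_of_nonneg tα tβ).1 h1
  refine ⟨hM, ?_, ?_, ?_⟩
  · rw [smul_mul_assoc, Matrix.trace_smul, smul_eq_mul] at h2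
    exact_mod_cast (mul_eq_zero.1 h2).resolve_right hβ0
  · rcases hγ0 with rfl | hγ0
    · rw [gammaProj_two, smul_zero]
    · rw [smul_mul_assoc, Matrix.trace_smul, smul_eq_mul] at h3
      rw [(mul_eq_zero.1 h3).resolve_right hγ0, zero_smul]
  · simpa only [alphaPart, Finset.sum_mul, Matrix.trace_sum, smul_mul_assoc, Matrix.trace_smul,
      smul_eq_mul] using h1

/-- For a positive matrix a vector of zero quadratic form lies in the kernel; this converts
slackness identities into linear equations. -/
theorem mulVec_eq_zero_of_form {M : Matrix (Fin 2) (Fin 2) ℂ} (hM : M.PosSemidef) (x y : ℝ)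
    (h : M 0 0 * (x * x) + M 0 1 * (x * y) + M 1 0 * (x * y) + M 1 1 * (y * y) = 0) :
    (M 0 0 * x + M 0 1 * y = 0) ∧ M 1 0 * x + M 1 1 * y = 0 := by
  have h1 := (hM.dotProduct_mulVec_zero_iff ![(x : ℂ), (y : ℂ)]).1 (by
    simp only [dotProduct, Matrix.mulVec, Fin.sum_univ_two, Pi.star_apply, Matrix.cons_val_zero,
      Matrix.cons_val_one, Complex.star_def, Complex.conj_ofReal]
    linear_combination h)
  constructor
  · simpa [Matrix.mulVec, dotProduct, Fin.sum_univ_two] using congrFun h1 0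
  · simpa [Matrix.mulVec, dotProduct, Fin.sum_univ_two] using congrFun h1 1

theorem eq_zero_of_diag_form {M : Matrix (Fin 2) (Fin 2) ℂ} (hM : M.PosSemidef) {x y : ℝ}
    (hx : 0 < x) (hy : 0 < y) (h : M 0 0 * x + M 1 1 * y = 0) : M = 0 := by
  have hx' : (x : ℂ) ≠ 0 := by exact_mod_cast hx.ne'
  have hy' : (y : ℂ) ≠ 0 := by exact_mod_cast hy.ne'
  obtain ⟨h0, h1⟩ := (add_eq_zero_iff_of_nonneg
    (mul_nonneg hM.diag_nonneg (Complex.zero_le_real.2 hx.le))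
    (mul_nonneg hM.diag_nonneg (Complex.zero_le_real.2 hy.le))).1 h
  have h0 := (mul_eq_zero.1 h0).resolve_right hx'
  have h1 := (mul_eq_zero.1 h1).resolve_right hy'
  have h2 := mulVec_eq_zero_of_form hM 0 1 (by simp [h1])
  have h3 := mulVec_eq_zero_of_form hM 1 0 (by simp [h0])
  ext a b
  fin_cases a <;> fin_cases b
  · exact h0
  · simpa using h2.1
  · simpa using h3.2
  · exact h1

/-- A positive matrix with a prescribed kernel vector is a multiple of an optimal block. -/
theorem eq_smul_of_kernel {M : Matrix (Fin 2) (Fin 2) ℂ} (hM : M.PosSemidef) {e f c g ε : ℝ}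
    (hc : e * c = 1 / 2) (hg : f * g = 1 / 2) (hε : ε * ε = 1)
    (h : M 0 0 * (9 * (c * c)) - M 0 1 * (3 * ε * (c * g)) - M 1 0 * (3 * ε * (c * g)) +
      M 1 1 * (g * g) = 0) :
    M = (((M 1 1).re / (f * f) : ℝ) : ℂ) •
      !![(e * e / 9 : ℂ), (ε * (e * f / 3) : ℂ); (ε * (e * f / 3) : ℂ), (f * f : ℂ)] := by
  have hε' : (ε : ℂ) * ε = 1 := by exact_mod_cast hε
  -- The hypothesis is the quadratic form at (3c, -εg). Since ec = fg = 1/2, this vector is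
  -- orthogonal to (e/3, εf), whose outer square is the target block.
  obtain ⟨h0, h1⟩ := mulVec_eq_zero_of_form hM (3 * c) (- (ε * g)) (by
    push_cast
    linear_combination h + M 1 1 * (g * g) * hε')
  have hf : f ≠ 0 := fun h => by rw [h, zero_mul] at hg; norm_num at hg
  have hf' : (f : ℂ) ≠ 0 := by exact_mod_cast hf
  have hc' : (e : ℂ) * c = 1 / 2 := by
    rw [← Complex.ofReal_mul, hc]; norm_num
  have hg' : (f : ℂ) * g = 1 / 2 := by
    rw [← Complex.ofReal_mul, hg]; norm_num
  have h11 : M 1 1 = ((M 1 1).re : ℂ) := Complex.ext rfl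
    (Complex.le_def.1 (hM.diag_nonneg (i := 1))).2.symm
  push_cast at h0 h1
  have k0 : M 0 0 * (3 * f) = M 0 1 * (ε * e) := by
    linear_combination 2 * e * f * h0 - 6 * M 0 0 * f * hc' + 2 * M 0 1 * ε * e * hg'
  have k1 : M 1 0 * (3 * f) = M 1 1 * (ε * e) := by
    linear_combination 2 * e * f * h1 - 6 * M 1 0 * f * hc' + 2 * M 1 1 * ε * e * hg'
  have e10 : M 1 0 = (((M 1 1).re / (f * f) * (ε * (e * f / 3)) : ℝ) : ℂ) := by
    rw [h11] at k1
    push_cast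
    field_simp
    linear_combination k1
  have e01 : M 0 1 = (((M 1 1).re / (f * f) * (ε * (e * f / 3)) : ℝ) : ℂ) := by
    have := hM.1.apply 0 1
    rw [← this, e10, Complex.star_def, Complex.conj_ofReal]
  ext a b
  fin_cases a <;> fin_cases b
  · simp only [Fin.zero_eta, Matrix.smul_apply, Matrix.of_apply, Matrix.cons_val_zero, smul_eq_mul]
    rw [e01] at k0
    push_cast at k0 ⊢
    field_simp
    field_simp at k0
    linear_combination k0 + (M 1 1).re * e ^ 2 * hε'
  · simp [e01]
  · simp [e10]
  · change M 1 1 = _ * (f * f : ℂ)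
    conv_lhs => rw [h11]
    push_cast
    field_simp

theorem trace_alphaPart_mul_symABC (hd : 2 ≤ d) (M : Matrix (Fin 2) (Fin 2) ℂ) :
    (alphaPart d M * symABC d).trace = M 0 0 * d := by
  simp [alphaPart, add_mul, alphaBlock_mul_symABC, trace_alphaBlock hd]

theorem trace_alphaPart_mul_antiABC (hd : 2 ≤ d) (M : Matrix (Fin 2) (Fin 2) ℂ) :
    (alphaPart d M * antiABC d).trace = M 1 1 * d := by
  simp [alphaPart, add_mul, alphaBlock_mul_antiABC, trace_alphaBlock hd]

theorem patternOp_eq_alphaPart {s : Params} {l : Pattern} (hβ : s.β l = 0)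
    (hγ : (s.γ l : ℂ) • gammaProj d = 0) :
    patternOp d s l = ((d : ℂ) / patternCard d l) • alphaPart d (s.α l) := by
  rw [patternOp_eq, hβ, hγ, Complex.ofReal_zero, zero_smul, add_zero, add_zero]

/-- The blocks of an optimal symmetric instrument, up to normalization. -/
theorem exists_blocks_of_optimal (hd : 2 ≤ d) {s : Params}
    (hs : IsCloningStrategy (instrument d s))
    (hF : cloneFidelity (instrument d s) = 4 / (3 * (d : ℝ))) :
    ∃ z : ℂ, ∃ p q : ℝ, 0 ≤ p ∧ 0 ≤ q ∧ s.α .xxx = !![z, 0; 0, 0] ∧ s.α .xyx = (p : ℂ) • matB d ∧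
      s.α .xyy = (q : ℂ) • (sigmaZ * matB d * sigmaZ) ∧ s.α .xxy = 0 ∧
      (3 ≤ d → s.α .xyz = 0) := by
  have hd' : (2 : ℝ) ≤ d := by exact_mod_cast hd
  have hdm : (0 : ℝ) < d - 1 := by linarith
  have slack := fun i j k => slack_instrument hd hs hF i j k
  simp only [Fin.sum_univ_two, trace_alphaBlock_mul_slack hd] at slack
  have h0 : √(((d : ℝ) + 1) / 2) * psiNorm d 0 = 1 / 2 := sqrt_half_mul_psiNorm hd 0
  have h1 : √(((d : ℝ) - 1) / 2) * psiNorm d 1 = 1 / 2 := by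
    rw [sub_eq_add_neg]; exact sqrt_half_mul_psiNorm hd 1
  -- In units of the squared norms of Ψ^±, the dual weights become 4 and 4/3; after multiplication
  -- by 3, the slack for `xyx` and `xyy` is the form treated by `eq_smul_of_kernel`.
  have n0 : 2 / ((d : ℝ) + 1) = 4 * (psiNorm d 0 * psiNorm d 0) := by
    rw [psiNorm_mul_self hd, sgn_zero]; field_simp; norm_num
  have n1 : 2 / (3 * ((d : ℝ) - 1)) = 4 / 3 * (psiNorm d 1 * psiNorm d 1) := by
    rw [psiNorm_mul_self hd, sgn_one, ← sub_eq_add_neg]; field_simp; norm_num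
  have p0 : 0 < 2 / ((d : ℝ) + 1) := by positivity
  have p1 : 0 < 2 / (3 * ((d : ℝ) - 1)) := by positivity
  let u : Fin d := ⟨0, by omega⟩
  let v : Fin d := ⟨1, by omega⟩
  have huv : u ≠ v := by simp [u, v]
  have hvu : v ≠ u := huv.symm
  have hF0 : √(((d : ℝ) - 1) / 2) * √(((d : ℝ) - 1) / 2) ≠ 0 := by
    rw [Real.mul_self_sqrt (by linarith)]; positivity
  rw [matB_eq hd, sigmaZ_mul_mul_sigmaZ]
  generalize √(((d : ℝ) + 1) / 2) = e at *
  generalize √(((d : ℝ) - 1) / 2) = f at *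
  have diag_nonneg : ∀ {M : Matrix (Fin 2) (Fin 2) ℂ}, M.PosSemidef → 0 ≤ (M 1 1).re / (f * f) :=
    fun hM => div_nonneg (Complex.le_def.1 (hM.diag_nonneg (i := 1))).1 (mul_self_nonneg f)
  obtain ⟨Pxxx, -, -, Txxx⟩ := slack u u u
  obtain ⟨Pxxy, -, -, Txxy⟩ := slack u u v
  obtain ⟨Pxyx, -, -, Txyx⟩ := slack u v u
  obtain ⟨Pxyy, -, -, Txyy⟩ := slack u v v
  simp only [pattern, huv, hvu, if_true, if_false, and_self, and_true, and_false, sgn_zero,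
    sgn_one, zero_ne_one, one_ne_zero] at Pxxx Txxx Pxxy Txxy Pxyx Txyx Pxyy Txyy
  -- For three equal indices the (+,+) and mixed coefficients of the slack vanish and only the (-,-)
  -- one survives; positivity then kills the off-diagonal entries as well.
  have Hxxx : s.α .xxx 1 1 = 0 := by
    rw [n0] at Txxx
    have : (2 / (3 * ((d : ℝ) - 1)) : ℂ) ≠ 0 := by exact_mod_cast p1.ne'
    refine (mul_eq_zero.1 ?_).resolve_right this
    push_cast at Txxx
    linear_combination Txxx
  have Kxxx := mulVec_eq_zero_of_form Pxxx 0 1 (by simp [Hxxx])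
  have K01 : s.α .xxx 0 1 = 0 := by simpa using Kxxx.1
  have K10 : s.α .xxx 1 0 = 0 := by
    rw [← Pxxx.1.apply 1 0, K01, star_zero]
  refine ⟨s.α .xxx 0 0, _, _, diag_nonneg Pxyx, diag_nonneg Pxyy, ?_,
    (eq_smul_of_kernel Pxyx h0 h1 (ε := 1) (by norm_num) ?_).trans ?_,
    (eq_smul_of_kernel Pxyy h0 h1 (ε := -1) (by norm_num) ?_).trans ?_, ?_, fun hd3 => ?_⟩
  · ext a b
    fin_cases a <;> fin_cases b <;> simp [K01, K10, Hxxx]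
  · rw [n0, n1] at Txyx
    push_cast at Txyx ⊢
    linear_combination 3 * Txyx
  · simp
  · rw [n0, n1] at Txyy
    push_cast at Txyy ⊢
    linear_combination 3 * Txyy
  · simp
  · refine eq_zero_of_diag_form Pxxy p0 p1 ?_
    push_cast at Txxy ⊢
    linear_combination Txxy
  · let w : Fin d := ⟨2, by omega⟩
    have hwu : w ≠ u := by simp [u, w]
    have hwv : w ≠ v := by simp [v, w]
    obtain ⟨Pxyz, -, -, Txyz⟩ := slack u v w
    simp only [pattern, huv, hwu, hwv, if_true, if_false, and_self, zero_ne_one,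
      one_ne_zero] at Pxyz Txyz
    refine eq_zero_of_diag_form Pxyz p0 p1 ?_
    push_cast at Txyz ⊢
    linear_combination Txyz

/-- Testing the normalization on P^± fixes the three free coefficients. The conclusion equates
instruments rather than parameters: at d = 2 the γ parameters and those of the pattern `xyz` do not
affect the instrument. -/
theorem exists_instrument_eq_optInstrument (hd : 2 ≤ d) {s : Params}
    (hs : IsCloningStrategy (instrument d s))
    (hF : cloneFidelity (instrument d s) = 4 / (3 * (d : ℝ))) :
    ∃ p ∈ Set.Icc (0 : ℝ) 1, instrument d s = optInstrument d p := by
  have hd0 : (d : ℂ) ≠ 0 := by exact_mod_cast (by omega : d ≠ 0)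
  have hdm : (d : ℂ) - 1 ≠ 0 := sub_ne_zero.2 (by exact_mod_cast (by omega : d ≠ 1))
  have op : ∀ i j k, patternOp d s (pattern i j k) =
      ((d : ℂ) / patternCard d (pattern i j k)) • alphaPart d (s.α (pattern i j k)) :=
    fun i j k => patternOp_eq_alphaPart (slack_instrument hd hs hF i j k).2.1
      (slack_instrument hd hs hF i j k).2.2.1
  obtain ⟨z, p, q, hp, hq, hxxx, hxyx, hxyy, hxxy, hxyz⟩ := exists_blocks_of_optimal hd hs hF
  obtain ⟨S, hS, hS1⟩ := hs.normalized
  let o : Fin d := ⟨0, by omega⟩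
  have hsum : S = alphaPart d (s.α .xxx) + alphaPart d (s.α .xyx) + alphaPart d (s.α .xyy) := by
    have h := congrArg (wireBlock · o) hS
    simp only [wireBlock_sum, wireBlock_tensorD, Matrix.one_apply_eq, one_smul,
      wireBlock_instrument, op] at h
    rw [← h, sum_pattern (fun l => ((d : ℂ) / patternCard d l) • alphaPart d (s.α l)) o]
    have hz : (((d : ℂ) - 1) * (d - 2)) • ((d : ℂ) / patternCard d .xyz) •
        alphaPart d (s.α .xyz) = 0 := by
      rcases Nat.lt_or_ge 2 d with h | h
      · simp [hxyz h, alphaPart]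
      · have : d = 2 := le_antisymm h hd
        simp [this]
    rw [hz, hxxy]
    simp only [patternCard_eq]
    have hz' : alphaPart d 0 = 0 := by simp [alphaPart]
    rw [hz']
    match_scalars <;> field_simp
  have t0 : (s.α .xxx 0 0 + s.α .xyx 0 0 + s.α .xyy 0 0) * d = d * (d + 1) / 2 := by
    rw [← trace_symProj, ← Matrix.one_mul (symProj d), ← hS1, trace_partialTrace_mul, hsum]
    change _ = Matrix.trace (_ * symABC d)
    simp only [add_mul, Matrix.trace_add, trace_alphaPart_mul_symABC hd]
  have t1 : (s.α .xxx 1 1 + s.α .xyx 1 1 + s.α .xyy 1 1) * d = d * (d - 1) / 2 := by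
    rw [← trace_antiProj, ← Matrix.one_mul (antiProj d), ← hS1, trace_partialTrace_mul, hsum]
    change _ = Matrix.trace (_ * antiABC d)
    simp only [add_mul, Matrix.trace_add, trace_alphaPart_mul_antiABC hd]
  have hB0 : matB d 0 0 = ((d : ℂ) + 1) / 18 := by
    simp only [matB, dPlus, Matrix.of_apply, Matrix.cons_val_zero]
    push_cast
    field_simp
    norm_num
  have hB1 : matB d 1 1 = ((d : ℂ) - 1) / 2 := by
    change ((dMinus d / d : ℝ) : ℂ) = _
    rw [dMinus]
    push_cast
    field_simp
  have hσ0 : (sigmaZ * matB d * sigmaZ) 0 0 = matB d 0 0 := by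
    rw [matB, sigmaZ_mul_mul_sigmaZ]; rfl
  have hσ1 : (sigmaZ * matB d * sigmaZ) 1 1 = matB d 1 1 := by
    rw [matB, sigmaZ_mul_mul_sigmaZ]; rfl
  have x00 : s.α .xxx 0 0 = z := by rw [hxxx]; rfl
  have x11 : s.α .xxx 1 1 = 0 := by rw [hxxx]; rfl
  rw [x00, hxyx, hxyy, Matrix.smul_apply, Matrix.smul_apply, hσ0, hB0, smul_eq_mul,
    smul_eq_mul] at t0
  rw [x11, hxyx, hxyy, Matrix.smul_apply, Matrix.smul_apply, hσ1, hB1, smul_eq_mul,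
    smul_eq_mul] at t1
  -- Only the blocks proportional to B and σ_z B σ_z have weight on P⁻, so its trace fixes p + q;
  -- the trace on P⁺ then determines z.
  have hpq' : (p : ℂ) + q = 1 := by
    refine mul_left_cancel₀ (mul_ne_zero hd0 hdm) ?_
    linear_combination 2 * t1
  have hpq : p + q = 1 := by exact_mod_cast hpq'
  have hz : z = ((8 * dPlus d / (9 * d) : ℝ) : ℂ) := by
    rw [dPlus]
    push_cast
    field_simp at t0 ⊢
    linear_combination t0 / 2 - ((d : ℂ) + 1) * hpq'
  have hA : s.α .xxx = matA d := by rw [hxxx, hz, matA]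
  refine ⟨p, ⟨hp, by linarith⟩, ?_⟩
  have hq' : q = 1 - p := by linarith
  subst hq'
  rw [optInstrument_eq]
  funext i j
  simp only [instrument]
  refine Finset.sum_congr rfl fun k _ => ?_
  rw [op, patternOp_eq_alphaPart (s := mixParams d p) rfl (by simp [mixParams])]
  -- The parameter of `xyz` is known to vanish only for d ≥ 3; at d = 2 no triple has that pattern.
  have : 3 ≤ d ∨ pattern i j k ≠ .xyz := by
    rcases Nat.lt_or_ge 2 d with h | h
    · exact Or.inl h
    · obtain rfl : d = 2 := le_antisymm h hd
      right
      fin_cases i <;> fin_cases j <;> fin_cases k <;> simp [pattern]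
  congr 3
  revert this
  cases pattern i j k
  · simp [mixParams, hA]
  · simp [mixParams, hxxy]
  · simp [mixParams, hxyx]
  · simp [mixParams, hxyy]
  · intro h
    simp [mixParams, hxyz (h.resolve_right (by simp))]

end uniqueness

end MeasurementCloning

end

theorem mainTheorem1 (d : ℕ) (hd : 2 ≤ d) :
    -- the figure of merit is a genuine integral
    (∀ R : Fin d → Fin d → Matrix (Wires d) (Wires d) ℂ, IsCloningStrategy R →
      Integrable (fun U : SU d => cloneFidelityAt R U) (haarSU d)) ∧
    -- the maximum over all cloning strategies
    IsGreatest {F : ℝ | ∃ R : Fin d → Fin d → Matrix (Wires d) (Wires d) ℂ,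
      IsCloningStrategy R ∧ cloneFidelity R = F} (4 / (3 * (d : ℝ))) ∧
    -- it is reached by the two choices and by all their convex combinations
    (∀ p ∈ Set.Icc (0 : ℝ) 1, IsCloningStrategy (optInstrument d p) ∧
      cloneFidelity (optInstrument d p) = 4 / (3 * (d : ℝ))) ∧
    -- and by no other strategy of the symmetric form
    (∀ s : Params, IsCloningStrategy (instrument d s) →
      cloneFidelity (instrument d s) = 4 / (3 * (d : ℝ)) →
      ∃ p ∈ Set.Icc (0 : ℝ) 1, instrument d s = optInstrument d p) ∧
    -- the measurement replicated by the equal-weight combination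
    (∀ (U : SU d) (i : Fin d), replicated (optInstrument d (1 / 2)) U i i =
      (8 / 9 : ℂ) • (symProj d * (vonNeumann U i ⊗ₖ 1) * symProj d)) ∧
    (∀ (U : SU d) (i j : Fin d), i ≠ j → replicated (optInstrument d (1 / 2)) U i j =
      (1 / ((d : ℂ) - 1)) • (matQ d 0 * (vonNeumann U i ⊗ₖ 1) * matQ d 0 +
        matQ d 1 * (vonNeumann U j ⊗ₖ 1) * matQ d 1)) := by
  refine ⟨fun R _ => Continuous.integrable_haarSU (continuous_cloneFidelityAt R),
    ⟨⟨optInstrument d 1, isCloningStrategy_optInstrument hd (by simp),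
      cloneFidelity_optInstrument hd 1⟩, ?_⟩,
    fun p hp => ⟨isCloningStrategy_optInstrument hd hp, cloneFidelity_optInstrument hd p⟩,
    fun s hs hF => exists_instrument_eq_optInstrument hd hs hF,
    fun U i => replicated_optInstrument_self hd U i,
    fun U i j hij => replicated_optInstrument_of_ne hd U hij⟩
  rintro F ⟨R, hR, rfl⟩
  exact cloneFidelity_le hd hR
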